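/- Consider $N$ followers ($i=1,\dots,N$) $$\dot x_i=(A_i+\Delta A_i)x_i+(B_i+\Delta B_i)u_i,\qquad y_i=(C_i+\Delta C_i)x_i+(D_i+\Delta D_i)u_i,$$ with $x_i\in\mathbb R^{n_i}$, $u_i\in\mathbb R^{p_i}$, $y_i\in\mathbb R^{q}$ and real matrices, where $(A_i,B_i)$ is controllable and $(C_i,A_i)$ is observable, and let $w$ be the vector of all entries of all the uncertainties $\Delta A_i,\Delta B_i,\Delta C_i,\Delta D_i$. The leader (node $0$) is $\dot v=Sv$, $y_0=-Fv$, with $v\in\mathbb R^m$ and $(F,S)$ observable. Let $\mathcal G_1,\dots,\mathcal G_\kappa$ be weighted digraphs on the nodes $0,1,\dots,N$ with weights $a_{ij}\ge 0$ ($a_{ij}>0$ iff there is an arc from $j$ to $i$), $a_{ii}=0$ and $a_{0j}=0$. Assume that in each of them there is a directed path from node $0$ to every other node, and that $a_{ij}=a_{ji}$ for $i,j\ge 1$. The communication graph at time $t$ is $\mathcal G_{\sigma(t)}$, with weights $a_{ij}(t)$, where the switching signal $\sigma:[0,\infty)\to\{1,\dots,\kappa\}$ is constant on intervals $[t_k,t_{k+1})$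 with $t_0=0$ and $t_{k+1}-t_k\ge\tau_0$ for all $k\ge 0$, for some $\tau_0>0$. Assume further that for every (complex) eigenvalue $\lambda$ of $S$ and every $i$, $$\operatorname{rank}\begin{bmatrix}A_i-\lambda I&B_i\\ C_i&D_i\end{bmatrix}=n_i+q .$$ Let $\alpha(s)=s^{p_m}+\alpha_1s^{p_m-1}+\dots+\alpha_{p_m}$ be the minimal polynomial of $S$, let $\beta$ be the $p_m\times p_m$ matrix with ones on the superdiagonal, last row $(-\alpha_{p_m},\dots,-\alpha_1)$ and zeros elsewhere, let $\gamma=(0,\dots,0,1)^T\in\mathbb R^{p_m}$, and put $G_1=I_q\otimes\beta$, $G_2=I_q\otimes\gamma$. Then there exist real matrices $K_{1i},K_{2i},K_{3i}$ ($i=1,\dots,N$) and $L_0$, which do not depend on $\sigma$, such that the output-feedback law $$\begin{aligned}u_i&=K_{1i}\zeta_i+K_{2i}\xi_i,\\ \dot\zeta_i&=A_i\zeta_i+B_iu_i+K_{3i}(y_i-C_i\zeta_i-D_iu_i),\\ \dot\xi_i&=G_1\xi_i+G_2(y_i+F\eta_i),\\ \dot\eta_i&=S\eta_i-L_0F\sum_{j=0}^{N}a_{ij}(t)(\eta_i-\eta_j),\qquad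 \eta_0=v,\end{aligned}$$ solves the robust consensus tracking problem: there is an open neighbourhood $W$ of $w=0$ such that for all $w\in W$, all switching signals $\sigma$ as above and all initial values $x_i(0),v(0),\zeta_i(0),\xi_i(0),\eta_i(0)$, the closed-loop system has a solution on $[0,\infty)$, and along every such solution $e_i(t)=y_i(t)-y_0(t)\to 0$ as $t\to\infty$ for $i=1,\dots,N$. -/

import Mathlib

namespace RobustConsensus

open Matrix Filter Topology
open scoped Kronecker

/-- The pair `(A, B)` is controllable: the Kalman matrix `[B, A B, …, A ^ (n - 1) B]` has
rank `n`. -/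
def IsControllable {n p : ℕ} (A : Matrix (Fin n) (Fin n) ℝ) (B : Matrix (Fin n) (Fin p) ℝ) :
    Prop :=
  (Matrix.of fun (i : Fin n) (kj : Fin n × Fin p) => (A ^ (kj.1 : ℕ) * B) i kj.2).rank = n

/-- The pair `(C, A)` is observable: the matrix with block rows `C, C A, …, C A ^ (n - 1)` has
rank `n`. -/
def IsObservable {n q : ℕ} (C : Matrix (Fin q) (Fin n) ℝ) (A : Matrix (Fin n) (Fin n) ℝ) :
    Prop :=
  (Matrix.of fun (ki : Fin n × Fin q) (j : Fin n) => (C * A ^ (ki.1 : ℕ)) ki.2 j).rank = n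

/-- A weighted communication digraph on the nodes `0, 1, …, N`, where node `0` is the leader.
`weight i j` is `a_{ij}`; it is positive iff there is an arc from `j` to `i`. The leader receives
no information from the followers. -/
structure CommGraph (N : ℕ) where
  weight : Fin (N + 1) → Fin (N + 1) → ℝ
  weight_nonneg : ∀ i j, 0 ≤ weight i j
  weight_self : ∀ i, weight i i = 0
  weight_leader : ∀ j, weight 0 j = 0

/-- The graph is connected: there is a directed path from the leader to every node, and the
subgraph induced by the followers is undirected. -/
def CommGraph.IsConnected {N : ℕ} (G : CommGraph N) : Prop :=
  (∀ i, Relation.ReflTransGen (fun j k => 0 < G.weight k j) 0 i) ∧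
    ∀ i j : Fin N, G.weight i.succ j.succ = G.weight j.succ i.succ

/-- A switching signal on `[0, ∞)`: constant on each `[t k, t (k + 1))`, where `t 0 = 0` and
consecutive instants are at least a dwell time `τ₀ > 0` apart. -/
def IsSwitchingSignal {κ : ℕ} (σ : ℝ → Fin κ) : Prop :=
  ∃ τ₀ : ℝ, 0 < τ₀ ∧ ∃ t : ℕ → ℝ, t 0 = 0 ∧ (∀ k, τ₀ ≤ t (k + 1) - t k) ∧
    ∀ k, ∀ s ∈ Set.Ico (t k) (t (k + 1)), σ s = σ (t k)

/-- A solution on `[0, ∞)` of `ż = f(t)`: continuous, with right derivative `f t` at every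
`t ≥ 0` (the right-hand sides below are continuous between switching instants and continuous
from the right at them). -/
def IsSolution {ι : Type} [Fintype ι] (z f : ℝ → ι → ℝ) : Prop :=
  ContinuousOn z (Set.Ici 0) ∧ ∀ t, 0 ≤ t → HasDerivWithinAt z (f t) (Set.Ici t) t

/-- The nominal data of a leader and `N` heterogeneous followers. -/
structure MultiAgentSystem (N q m : ℕ) where
  /-- dimension of the state of each follower -/
  n : Fin N → ℕ
  /-- dimension of the input of each follower -/
  p : Fin N → ℕ
  A : ∀ i, Matrix (Fin (n i)) (Fin (n i)) ℝ
  B : ∀ i, Matrix (Fin (n i)) (Fin (p i)) ℝ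
  C : ∀ i, Matrix (Fin q) (Fin (n i)) ℝ
  D : ∀ i, Matrix (Fin q) (Fin (p i)) ℝ
  /-- The leader is `v̇ = S v`, with output `y₀ = - F v`. -/
  S : Matrix (Fin m) (Fin m) ℝ
  F : Matrix (Fin q) (Fin m) ℝ

namespace MultiAgentSystem

variable {N q m : ℕ} (M : MultiAgentSystem N q m)

/-- The uncertainty `w`: for each follower `i` the entries of the block matrix
`[ΔA_i, ΔB_i; ΔC_i, ΔD_i]`. -/
abbrev Uncertainty : Type :=
  ∀ i, Matrix (Fin (M.n i) ⊕ Fin q) (Fin (M.n i) ⊕ Fin (M.p i)) ℝ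

/-- `A_i(w) = A_i + ΔA_i` -/
def Aw (w : M.Uncertainty) (i : Fin N) : Matrix (Fin (M.n i)) (Fin (M.n i)) ℝ :=
  M.A i + (w i).toBlocks₁₁

/-- `B_i(w) = B_i + ΔB_i` -/
def Bw (w : M.Uncertainty) (i : Fin N) : Matrix (Fin (M.n i)) (Fin (M.p i)) ℝ :=
  M.B i + (w i).toBlocks₁₂

/-- `C_i(w) = C_i + ΔC_i` -/
def Cw (w : M.Uncertainty) (i : Fin N) : Matrix (Fin q) (Fin (M.n i)) ℝ :=
  M.C i + (w i).toBlocks₂₁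

/-- `D_i(w) = D_i + ΔD_i` -/
def Dw (w : M.Uncertainty) (i : Fin N) : Matrix (Fin q) (Fin (M.p i)) ℝ :=
  M.D i + (w i).toBlocks₂₂

/-- The transmission zero condition: `[A_i - λ I, B_i; C_i, D_i]` has rank `n_i + q` for every
follower `i` and every (complex) eigenvalue `λ` of `S`. -/
def TransmissionZeroCondition : Prop :=
  ∀ lam : ℂ, Module.End.HasEigenvalue (Matrix.toLin' (M.S.map Complex.ofReal)) lam →
    ∀ i, (Matrix.fromBlocks ((M.A i).map Complex.ofReal - lam • 1) ((M.B i).map Complex.ofReal)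
      ((M.C i).map Complex.ofReal) ((M.D i).map Complex.ofReal)).rank = M.n i + q

/-- The degree `p_m` of the minimal polynomial of `S`. -/
noncomputable def pm : ℕ := (minpoly ℝ M.S).natDegree

/-- The companion matrix `β` of the minimal polynomial of `S`: ones on the superdiagonal, and the
last row holds the negated coefficients, constant coefficient first. -/
noncomputable def beta : Matrix (Fin M.pm) (Fin M.pm) ℝ :=
  Matrix.of fun k l =>
    if (k : ℕ) + 1 < M.pm then (if (l : ℕ) = k + 1 then 1 else 0)
    else -(minpoly ℝ M.S).coeff l

/-- The column `γ = col(0, …, 0, 1)`. -/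
noncomputable def gamma : Matrix (Fin M.pm) Unit ℝ :=
  Matrix.of fun k _ => if (k : ℕ) + 1 = M.pm then 1 else 0

/-- `G₁ = I_q ⊗ β` -/
noncomputable def G1 : Matrix (Fin q × Fin M.pm) (Fin q × Fin M.pm) ℝ :=
  (1 : Matrix (Fin q) (Fin q) ℝ) ⊗ₖ M.beta

/-- `G₂ = I_q ⊗ γ` -/
noncomputable def G2 : Matrix (Fin q × Fin M.pm) (Fin q) ℝ :=
  ((1 : Matrix (Fin q) (Fin q) ℝ) ⊗ₖ M.gamma).submatrix id fun j => (j, ())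

/-- The gain matrices of the output-feedback law. -/
structure Gains where
  K1 : ∀ i, Matrix (Fin (M.p i)) (Fin (M.n i)) ℝ
  K2 : ∀ i, Matrix (Fin (M.p i)) (Fin q × Fin M.pm) ℝ
  K3 : ∀ i, Matrix (Fin (M.n i)) (Fin q) ℝ
  L0 : Matrix (Fin m) (Fin q) ℝ

/-- The states of the closed loop: the leader `v`, the followers `x i`, the state observers `ζ i`,
the internal models `ξ i` and the observers `η i` of the leader. -/
structure State where
  v : Fin m → ℝ
  x : ∀ i, Fin (M.n i) → ℝ
  ζ : ∀ i, Fin (M.n i) → ℝ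
  ξ : Fin N → Fin q × Fin M.pm → ℝ
  η : Fin N → Fin m → ℝ

namespace State

variable {M}
variable (s : M.State)

/-- The control `u_i = K_{1i} ζ_i + K_{2i} ξ_i`. -/
noncomputable def u (K : M.Gains) (i : Fin N) : Fin (M.p i) → ℝ :=
  K.K1 i *ᵥ s.ζ i + K.K2 i *ᵥ s.ξ i

/-- The output `y_i = C_i(w) x_i + D_i(w) u_i`. -/
noncomputable def y (K : M.Gains) (w : M.Uncertainty) (i : Fin N) : Fin q → ℝ :=
  M.Cw w i *ᵥ s.x i + M.Dw w i *ᵥ s.u K i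

/-- The output `y₀ = - F v` of the leader. -/
noncomputable def y0 : Fin q → ℝ := -(M.F *ᵥ s.v)

/-- The tracking error `e_i = y_i - y₀`. -/
noncomputable def e (K : M.Gains) (w : M.Uncertainty) (i : Fin N) : Fin q → ℝ :=
  s.y K w i - s.y0

/-- `η_{vi} = ∑_{j = 0}^N a_{ij} (η_i - η_j)` with `η_0 = v`. -/
noncomputable def etaV (G : CommGraph N) (i : Fin N) : Fin m → ℝ :=
  ∑ j : Fin (N + 1), G.weight i.succ j •
    (s.η i - (Fin.cons s.v s.η : Fin (N + 1) → Fin m → ℝ) j)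

end State

/-- `s` is a trajectory on `[0, ∞)` of the closed loop formed by the leader, the followers with
uncertainty `w`, and the output-feedback law with gains `K`, under the time-varying communication
graph `G t`. -/
structure IsTrajectory (K : M.Gains) (w : M.Uncertainty) (G : ℝ → CommGraph N)
    (s : ℝ → M.State) : Prop where
  leader : IsSolution (fun t => (s t).v) fun t => M.S *ᵥ (s t).v
  follower : ∀ i, IsSolution (fun t => (s t).x i) fun t =>
    M.Aw w i *ᵥ (s t).x i + M.Bw w i *ᵥ (s t).u K i
  stateObserver : ∀ i, IsSolution (fun t => (s t).ζ i) fun t =>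
    M.A i *ᵥ (s t).ζ i + M.B i *ᵥ (s t).u K i
      + K.K3 i *ᵥ ((s t).y K w i - M.C i *ᵥ (s t).ζ i - M.D i *ᵥ (s t).u K i)
  internalModel : ∀ i, IsSolution (fun t => (s t).ξ i) fun t =>
    M.G1 *ᵥ (s t).ξ i + M.G2 *ᵥ ((s t).y K w i + M.F *ᵥ (s t).η i)
  leaderObserver : ∀ i, IsSolution (fun t => (s t).η i) fun t =>
    M.S *ᵥ (s t).η i - K.L0 *ᵥ (M.F *ᵥ (s t).etaV (G t) i)

/-- The output-feedback law with gains `K` solves the robust consensus tracking problem for the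
graphs `G k`: on an open neighbourhood of `w = 0`, for every switching signal and every initial
condition, the closed loop has a trajectory, and all tracking errors tend to `0` along it. -/
def SolvesRobustConsensusTracking {κ : ℕ} (G : Fin κ → CommGraph N) (K : M.Gains) : Prop :=
  ∃ W : Set M.Uncertainty, IsOpen W ∧ 0 ∈ W ∧ ∀ w ∈ W,
    ∀ σ : ℝ → Fin κ, IsSwitchingSignal σ → ∀ s₀ : M.State,
      (∃ s : ℝ → M.State, s 0 = s₀ ∧ M.IsTrajectory K w (fun t => G (σ t)) s) ∧
      ∀ s : ℝ → M.State, s 0 = s₀ → M.IsTrajectory K w (fun t => G (σ t)) s →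
        ∀ i, Tendsto (fun t => (s t).e K w i) atTop (𝓝 0)

end MultiAgentSystem

end RobustConsensus

/-!
The proof rests on quadratic Lyapunov functions with a prescribed rate of decay (`DecaysAt`).

*Observer of the leader.* The errors `ηᵢ - v` form an autonomous switched system. Connectedness
makes the Laplacians grounded at the leader positive definite (`CommGraph.energy_pos`), so with the gain
`L₀ = μ/2 P⁻¹ Fᵀ`, where `P` is a weighted observability Gramian of `(F, S)` over `[0, 1]`
(`exists_gramian`) and `μ` is large, the form `∑ᵢ P ηᵢ ηᵢ` is a Lyapunov function common to all the
graphs (`exists_decaysAt_observerError`). Hence arbitrary switching is harmless.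

*Followers.* By the Hautus test, the transmission zero condition makes the follower augmented by the
internal model controllable (`augmented_controllable`), so state feedback and an observer give the
nominal closed loop of `(x, ζ, ξ)` any rate of decay (`decaysAt_followerField_zero`), and all but a
little of that rate survives small perturbations (`DecaysAt.eventually`); this yields `W`. No
spectral assumption on `S` is made: it is enough to choose the rate larger than `S` can shrink anything,
since then the Sylvester equation for the steady state `(x, ζ, ξ) = X v` is solvable
(`DecaysAt.exists_sylvester`). The internal model forces the tracking error on this steady state to
vanish (`internalModel_input_eq_zero`). The deviation from the steady state is a decaying system
driven by the observer error, and such a cascade decays (`DecaysAt.cascade`), which proves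
`IsTrajectory.tendsto_e`. Trajectories exist because exponentials can be glued at the switching
instants (`exists_switched_solution`).
-/

namespace RobustConsensus

open Matrix Filter Topology

/-! ### Common quadratic Lyapunov functions -/

section Lyapunov

variable {E E₁ E₂ : Type*} [NormedAddCommGroup E] [NormedSpace ℝ E]
  [NormedAddCommGroup E₁] [NormedSpace ℝ E₁] [NormedAddCommGroup E₂] [NormedSpace ℝ E₂]

/-- On a finite-dimensional space, a continuous function that is homogeneous of degree two is
dominated by a multiple of any positive one. -/
lemma exists_le_mul_of_homogeneous [FiniteDimensional ℝ E] {g h : E → ℝ} (hg : Continuous g)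
    (hh : Continuous h) (hg2 : ∀ (c : ℝ) x, g (c • x) = c ^ 2 * g x)
    (hh2 : ∀ (c : ℝ) x, h (c • x) = c ^ 2 * h x) (hpos : ∀ x, x ≠ 0 → 0 < h x) :
    ∃ K : ℝ, 0 < K ∧ ∀ x, g x ≤ K * h x := by
  have hne : ∀ x ∈ Metric.sphere (0 : E) 1, h x ≠ 0 := fun x hx =>
    (hpos x (by rintro rfl; simp at hx)).ne'
  obtain ⟨B, hB⟩ := (isCompact_sphere (0 : E) 1).bddAbove_image
    (hg.continuousOn.div hh.continuousOn hne)
  refine ⟨max B 1, by positivity, fun x => ?_⟩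
  by_cases hx : x = 0
  · have h1 := hg2 0 0
    have h2 := hh2 0 0
    simp only [smul_zero] at h1 h2
    subst hx
    rw [h1, h2]; simp
  · have hu : ‖x‖⁻¹ • x ∈ Metric.sphere (0 : E) 1 := by
      simp [norm_smul, hx]
    have h1 : g (‖x‖⁻¹ • x) / h (‖x‖⁻¹ • x) ≤ B := hB ⟨_, hu, rfl⟩
    have hn : ‖x‖ ≠ 0 := by simpa using hx
    rw [hg2, hh2, mul_div_mul_left _ _ (by positivity), div_le_iff₀ (hpos x hx)] at h1
    exact h1.trans (mul_le_mul_of_nonneg_right (le_max_left _ _) (hpos x hx).le)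

/-- A symmetric positive definite bilinear form. -/
structure IsLyapunovForm (P : E →L[ℝ] E →L[ℝ] ℝ) : Prop where
  symm : ∀ x y, P x y = P y x
  pos : ∀ x, x ≠ 0 → 0 < P x x

lemma IsLyapunovForm.nonneg {P : E →L[ℝ] E →L[ℝ] ℝ} (hP : IsLyapunovForm P) (x : E) :
    0 ≤ P x x := by
  by_cases hx : x = 0
  · simp [hx]
  · exact (hP.pos x hx).le

/-- Young's inequality `P x y ≤ ε P x x + (4 ε)⁻¹ P y y`. -/
lemma IsLyapunovForm.apply_le {P : E →L[ℝ] E →L[ℝ] ℝ} (hP : IsLyapunovForm P) {ε : ℝ}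
    (hε : 0 < ε) (x y : E) : P x y ≤ ε * P x x + (4 * ε)⁻¹ * P y y := by
  have h := hP.nonneg ((2 * ε) • x - y)
  simp only [map_sub, map_smul, _root_.sub_apply, _root_.smul_apply,
    smul_eq_mul, hP.symm y x] at h
  have h3 : P x y * (4 * ε) ≤ (ε * P x x + (4 * ε)⁻¹ * P y y) * (4 * ε) := by
    rw [add_mul, mul_comm (4 * ε)⁻¹, inv_mul_cancel_right₀ (by positivity)]
    linarith
  exact le_of_mul_le_mul_right h3 (by positivity)

/-- The vector fields `f i` share a quadratic Lyapunov function `P x x`, which decreases along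
each of them at the rate `2 a`. -/
def DecaysAt {ι : Type*} (f : ι → E → E) (a : ℝ) : Prop :=
  ∃ P : E →L[ℝ] E →L[ℝ] ℝ, IsLyapunovForm P ∧ ∀ i x, P x (f i x) ≤ -a * P x x

lemma DecaysAt.of_injective {ι : Type*} {f : ι → E → E} {g : ι → E₁ → E₁} {a : ℝ}
    (hg : DecaysAt g a) (T : E →L[ℝ] E₁) (hT : Function.Injective T)
    (h : ∀ i x, T (f i x) = g i (T x)) : DecaysAt f a := by
  obtain ⟨P, hP, hd⟩ := hg
  refine ⟨P.bilinearComp T T, ⟨fun x y => hP.symm _ _, fun x hx => hP.pos _ ?_⟩, fun i x => ?_⟩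
  · exact fun h0 => hx ((map_eq_zero_iff T hT).1 h0)
  · simp only [ContinuousLinearMap.bilinearComp_apply, h]
    exact hd i _

/-- A cascade of two decaying systems decays, at any smaller rate: the second Lyapunov function
enters with a weight so large that it absorbs the coupling `g`. -/
lemma DecaysAt.cascade [FiniteDimensional ℝ E₁] [FiniteDimensional ℝ E₂] {ι : Type*}
    {f₁ : ι → E₁ → E₁} {f₂ : ι → E₂ → E₂}
    {a b : ℝ} (h₁ : DecaysAt f₁ a) (h₂ : DecaysAt f₂ a) (g : E₂ →L[ℝ] E₁) (hab : b < a) :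
    DecaysAt (fun i (z : E₁ × E₂) => (f₁ i z.1 + g z.2, f₂ i z.2)) b := by
  obtain ⟨P, hP, hd₁⟩ := h₁
  obtain ⟨Q, hQ, hd₂⟩ := h₂
  have hε : 0 < a - b := sub_pos.2 hab
  obtain ⟨K, hK, hKle⟩ := exists_le_mul_of_homogeneous (g := fun y => P (g y) (g y))
    (h := fun y => Q y y) (by fun_prop) (by fun_prop) (fun c x => by simp; ring)
    (fun c x => by simp; ring) hQ.pos
  set ε := a - b with hεdef
  set c := K / (4 * ε ^ 2) with hc
  have hc0 : 0 < c := by positivity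
  refine ⟨P.bilinearComp (.fst ℝ E₁ E₂) (.fst ℝ E₁ E₂)
    + c • Q.bilinearComp (.snd ℝ E₁ E₂) (.snd ℝ E₁ E₂), ⟨fun x y => ?_, fun x hx => ?_⟩,
    fun i x => ?_⟩
  · simp [hP.symm x.1, hQ.symm x.2]
  · simp only [_root_.add_apply, ContinuousLinearMap.bilinearComp_apply,
      _root_.smul_apply, smul_eq_mul, ContinuousLinearMap.coe_fst',
      ContinuousLinearMap.coe_snd']
    by_cases h1 : x.1 = 0
    · have h2 : x.2 ≠ 0 := fun h2 => hx (Prod.ext h1 h2)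
      have := mul_pos hc0 (hQ.pos _ h2)
      linarith [hP.nonneg x.1]
    · have := mul_nonneg hc0.le (hQ.nonneg x.2)
      linarith [hP.pos _ h1]
  · simp only [_root_.add_apply, ContinuousLinearMap.bilinearComp_apply,
      _root_.smul_apply, smul_eq_mul, ContinuousLinearMap.coe_fst',
      ContinuousLinearMap.coe_snd', map_add]
    have e1 := hd₁ i x.1
    have e2 := mul_le_mul_of_nonneg_left (hd₂ i x.2) hc0.le
    have e3 := hP.apply_le hε x.1 (g x.2)
    have e4 : (4 * ε)⁻¹ * P (g x.2) (g x.2) ≤ (4 * ε)⁻¹ * (K * Q x.2 x.2) :=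
      mul_le_mul_of_nonneg_left (hKle x.2) (by positivity)
    have e5 : (4 * ε)⁻¹ * (K * Q x.2 x.2) = ε * (c * Q x.2 x.2) := by
      rw [hc]; field_simp
    have e6 : b = a - ε := by rw [hεdef]; ring
    rw [e6]
    nlinarith

/-- Decay persists, at any smaller rate, under small perturbations of the vector field. -/
lemma DecaysAt.eventually [FiniteDimensional ℝ E] {X : Type*} [TopologicalSpace X]
    {f : X → E → E} {w₀ : X} {a b : ℝ} (h : DecaysAt (fun _ : Unit => f w₀) a)
    (hf : Continuous fun p : X × E => f p.1 p.2) (hsmul : ∀ w (c : ℝ) x, f w (c • x) = c • f w x)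
    (hab : b < a) : ∀ᶠ w in 𝓝 w₀, DecaysAt (fun _ : Unit => f w) b := by
  obtain ⟨P, hP, hd⟩ := h
  have hcont : Continuous fun p : X × E => P p.2 (f p.1 p.2) + b * P p.2 p.2 := by fun_prop
  have key : ∀ᶠ w in 𝓝 w₀, ∀ x ∈ Metric.sphere (0 : E) 1, P x (f w x) + b * P x x < 0 := by
    refine (isCompact_sphere (0 : E) 1).eventually_forall_of_forall_eventually fun x hx => ?_
    refine hcont.continuousAt.eventually_lt continuousAt_const ?_
    have h1 := hd () x
    have h2 : 0 < P x x := hP.pos x (by rintro rfl; simp at hx)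
    have h3 := mul_pos (sub_pos.2 hab) h2
    simp only
    linarith
  filter_upwards [key] with w hw
  refine ⟨P, hP, fun _ x => ?_⟩
  by_cases hx : x = 0
  · simp [hx]
  have hn : 0 < ‖x‖ := by simpa using hx
  have h1 := hw (‖x‖⁻¹ • x) (by simp [norm_smul, hx])
  simp only [hsmul, map_smul, _root_.smul_apply, smul_eq_mul] at h1
  have h2 : P x (f w x) + b * P x x < 0 := by
    by_contra hcon
    have : 0 ≤ ‖x‖⁻¹ * (‖x‖⁻¹ * (P x (f w x) + b * P x x)) := by
      have := not_lt.1 hcon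
      positivity
    linarith
  linarith

/-- Trajectories of decaying systems converge to zero, for whatever switching between them. -/
lemma DecaysAt.tendsto_zero [FiniteDimensional ℝ E] {ι : Type*} {f : ι → E → E} {a : ℝ}
    (hf : DecaysAt f a) (ha : 0 < a) {z : ℝ → E} {σ : ℝ → ι} (hz : ContinuousOn z (Set.Ici 0))
    (hd : ∀ t, 0 ≤ t → HasDerivWithinAt z (f (σ t) (z t)) (Set.Ici t) t) :
    Tendsto z atTop (𝓝 0) := by
  obtain ⟨P, hP, hdec⟩ := hf
  obtain ⟨K, hK, hle⟩ := exists_le_mul_of_homogeneous (g := fun x : E => ‖x‖ ^ 2)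
    (h := fun x => P x x) (by fun_prop) (by fun_prop)
    (fun c x => by simp [norm_smul, mul_pow]) (fun c x => by simp; ring) hP.pos
  set V : ℝ → ℝ := fun t => Real.exp (2 * a * t) * P (z t) (z t) with hV
  have hVbound : ∀ t, 0 ≤ t → V t ≤ V 0 := by
    intro t ht
    refine image_le_of_deriv_right_le_deriv_boundary (f := V) (a := 0) (b := t)
      (f' := fun s => Real.exp (2 * a * s) * (2 * a) * P (z s) (z s) + Real.exp (2 * a * s) *
        (P (f (σ s) (z s)) (z s) + P (z s) (f (σ s) (z s))))
      (B := fun _ => V 0) (B' := fun _ => 0) ?_ ?_ le_rfl continuousOn_const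
      (fun x _ => hasDerivWithinAt_const _ _ _) ?_ ⟨ht, le_rfl⟩
    · have h1 : ContinuousOn z (Set.Icc 0 t) := hz.mono Set.Icc_subset_Ici_self
      have h2 : ContinuousOn (fun s => Real.exp (2 * a * s)) (Set.Icc 0 t) := by fun_prop
      exact h2.mul ((P.continuous.comp_continuousOn h1).clm_apply h1)
    · intro s hs
      have h1 := hd s hs.1
      have h2 : HasDerivWithinAt (fun s => P (z s)) (P (f (σ s) (z s))) (Set.Ici s) s :=
        P.hasFDerivAt.comp_hasDerivWithinAt s h1
      have h3 : HasDerivAt (fun s => Real.exp (2 * a * s)) (Real.exp (2 * a * s) * (2 * a)) s := by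
        have := ((hasDerivAt_id s).const_mul (2 * a)).exp
        simpa using this
      exact h3.hasDerivWithinAt.mul (h2.clm_apply h1)
    · intro s _
      have h1 := hdec (σ s) (z s)
      have h2 := (Real.exp_pos (2 * a * s)).le
      simp only [hP.symm (f (σ s) (z s)) (z s)]
      nlinarith [mul_le_mul_of_nonneg_left h1 h2]
  have hbound : ∀ t, 0 ≤ t → ‖z t‖ ^ 2 ≤ K * V 0 * Real.exp (-(2 * a * t)) := by
    intro t ht
    have h1 := hVbound t ht
    have h2 : P (z t) (z t) = Real.exp (-(2 * a * t)) * V t := by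
      simp only [hV, ← mul_assoc, ← Real.exp_add]; simp
    calc ‖z t‖ ^ 2 ≤ K * P (z t) (z t) := hle _
      _ = K * Real.exp (-(2 * a * t)) * V t := by rw [h2]; ring
      _ ≤ K * Real.exp (-(2 * a * t)) * V 0 := by gcongr
      _ = _ := by ring
  have hlim : Tendsto (fun t : ℝ => K * V 0 * Real.exp (-(2 * a * t))) atTop (𝓝 0) := by
    have h1 : Tendsto (fun t : ℝ => 2 * a * t) atTop atTop :=
      tendsto_id.const_mul_atTop (by positivity)
    simpa using (Real.tendsto_exp_neg_atTop_nhds_zero.comp h1).const_mul (K * V 0)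
  have hsq : Tendsto (fun t => ‖z t‖ ^ 2) atTop (𝓝 0) :=
    squeeze_zero' (Eventually.of_forall fun t => by positivity)
      ((eventually_ge_atTop 0).mono hbound) hlim
  rw [tendsto_zero_iff_norm_tendsto_zero]
  have := hsq.sqrt
  simpa [Real.sqrt_sq] using this

/-- If `f` decays faster than `S` can shrink anything, the Sylvester equation
`X S = f X + R` is solvable. -/
lemma DecaysAt.exists_sylvester [FiniteDimensional ℝ E] {m : ℕ} {f : E →ₗ[ℝ] E} {a : ℝ}
    (hf : DecaysAt (fun _ : Unit => f) a) (S : Matrix (Fin m) (Fin m) ℝ)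
    (ha : ∑ j, ∑ k, |S k j| < a) (R : (Fin m → ℝ) →ₗ[ℝ] E) :
    ∃ X : (Fin m → ℝ) →ₗ[ℝ] E, ∀ v, X (S *ᵥ v) = f (X v) + R v := by
  obtain ⟨P, hP, hd⟩ := hf
  let Φ : ((Fin m → ℝ) →ₗ[ℝ] E) →ₗ[ℝ] ((Fin m → ℝ) →ₗ[ℝ] E) :=
    LinearMap.lcomp ℝ E S.mulVecLin - LinearMap.compRight ℝ f
  have hΦ : ∀ X v, Φ X v = X (S *ᵥ v) - f (X v) := fun X v => by simp [Φ]
  have hinj : Function.Injective Φ := by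
    rw [← LinearMap.ker_eq_bot, LinearMap.ker_eq_bot']
    intro X hX
    have hX' : ∀ v, X (S *ᵥ v) = f (X v) := fun v => by
      have := hΦ X v
      rw [hX] at this
      exact (sub_eq_zero.1 this.symm)
    let e : Fin m → E := fun j => X (Pi.single j 1)
    have hfe : ∀ j, f (e j) = ∑ k, S k j • e k := fun j => by
      have h1 : S *ᵥ Pi.single j 1 = ∑ k, S k j • Pi.single k (1 : ℝ) := by
        ext l
        simp [Finset.sum_apply, Pi.single_apply]
      simp only [e]
      rw [← hX', h1, map_sum]
      simp only [map_smul]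
    set V : ℝ := ∑ j, P (e j) (e j) with hVdef
    have hVle : ∀ j, P (e j) (e j) ≤ V := fun j =>
      Finset.single_le_sum (f := fun j => P (e j) (e j)) (fun j _ => hP.nonneg _)
        (Finset.mem_univ j)
    have hV0 : 0 ≤ V := Finset.sum_nonneg fun j _ => hP.nonneg _
    have habs : ∀ j k, |P (e j) (e k)| ≤ V := fun j k => by
      have h1 := hP.apply_le (ε := 1 / 2) (by norm_num) (e j) (e k)
      have h2 := hP.apply_le (ε := 1 / 2) (by norm_num) (e j) (-e k)
      simp only [map_neg, _root_.neg_apply] at h2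
      have h3 := hVle j
      have h4 := hVle k
      rw [abs_le]
      constructor <;> norm_num at h1 h2 <;> linarith
    have hlow : ∀ j, -(a * P (e j) (e j)) ≥ -((∑ k, |S k j|) * V) := fun j => by
      have h1 : P (e j) (f (e j)) ≤ -a * P (e j) (e j) := hd () (e j)
      rw [hfe, map_sum] at h1
      have h2 : -((∑ k, |S k j|) * V) ≤ ∑ k, P (e j) (S k j • e k) := by
        rw [Finset.sum_mul, ← Finset.sum_neg_distrib]
        refine Finset.sum_le_sum fun k _ => ?_
        rw [map_smul, smul_eq_mul]
        have h3 : |S k j * P (e j) (e k)| ≤ |S k j| * V := by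
          rw [abs_mul]; exact mul_le_mul_of_nonneg_left (habs j k) (abs_nonneg _)
        exact (abs_le.1 h3).1
      linarith
    have hsum : a * V ≤ (∑ j, ∑ k, |S k j|) * V := by
      rw [hVdef, Finset.mul_sum, ← hVdef, Finset.sum_mul]
      exact Finset.sum_le_sum fun j _ => by linarith [hlow j]
    have hVz : V = 0 := by
      nlinarith
    have hez : ∀ j, e j = 0 := fun j => by
      by_contra hne
      linarith [hP.pos _ hne, hVle j]
    refine LinearMap.pi_ext' fun j => LinearMap.ext_ring ?_
    simpa [e] using hez j
  obtain ⟨X, hX⟩ := (LinearMap.injective_iff_surjective.1 hinj) R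
  refine ⟨X, fun v => ?_⟩
  rw [← hX, hΦ]
  abel

end Lyapunov

/-! ### Observability Gramians and gains of prescribed decay rate -/

section Gramian

variable {E : Type*} [NormedAddCommGroup E] [NormedSpace ℝ E] [FiniteDimensional ℝ E]

/-- The weighted observability Gramian `∫₀¹ exp(-(A + a)t)ᵀ R exp(-(A + a)t) dt`. -/
lemma exists_gramian (A : E →L[ℝ] E) (R : E →L[ℝ] E →L[ℝ] ℝ) (hsymm : ∀ x y, R x y = R y x)
    (hnonneg : ∀ x, 0 ≤ R x x) (hobs : ∀ x, (∀ k, R ((A ^ k) x) ((A ^ k) x) = 0) → x = 0)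
    (a : ℝ) : ∃ P : E →L[ℝ] E →L[ℝ] ℝ, IsLyapunovForm P ∧
      ∀ x, P x (A x) ≤ -a * P x x + 1 / 2 * R x x := by
  have : CompleteSpace E := FiniteDimensional.complete ℝ E
  set A' : E →L[ℝ] E := -(A + a • 1) with hA'
  set φ : ℝ → E →L[ℝ] E := fun t => NormedSpace.exp (t • A') with hφ
  have hφd : ∀ t, HasDerivAt φ (φ t * A') t := fun t => hasDerivAt_exp_smul_const A' t
  have hφc : Continuous φ := continuous_iff_continuousAt.2 fun t => (hφd t).continuousAt
  have hφ0 : φ 0 = 1 := by simp [hφ]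
  have hBc : Continuous fun t => R.bilinearComp (φ t) (φ t) := by
    simp only [continuous_clm_apply, ContinuousLinearMap.bilinearComp_apply]
    intro x y
    fun_prop
  set P : E →L[ℝ] E →L[ℝ] ℝ := ∫ t in (0 : ℝ)..1, R.bilinearComp (φ t) (φ t) with hP
  have hPapp : ∀ x y, P x y = ∫ t in (0 : ℝ)..1, R (φ t x) (φ t y) := fun x y => by
    rw [hP, ContinuousLinearMap.intervalIntegral_apply (hBc.intervalIntegrable _ _),
      ContinuousLinearMap.intervalIntegral_apply]
    · rfl
    · exact (hBc.clm_apply continuous_const).intervalIntegrable _ _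
  have hint : ∀ x y, Continuous fun t => R (φ t x) (φ t y) := fun x y => by fun_prop
  have hderiv : ∀ x t, HasDerivAt (fun t => R (φ t x) (φ t x)) (2 * R (φ t x) (φ t (A' x))) t := by
    intro x t
    have h1 : HasDerivAt (fun t => φ t x) (φ t (A' x)) t := by
      simpa using (hφd t).clm_apply (hasDerivAt_const t x)
    have h2 := (R.hasFDerivAt.comp_hasDerivAt t h1).clm_apply h1
    have e : R (φ t (A' x)) (φ t x) + R (φ t x) (φ t (A' x)) = 2 * R (φ t x) (φ t (A' x)) := by
      rw [hsymm]; ring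
    rw [← e]
    exact h2
  refine ⟨P, ⟨fun x y => ?_, fun x hx => ?_⟩, fun x => ?_⟩
  · rw [hPapp, hPapp]
    exact intervalIntegral.integral_congr fun t _ => hsymm _ _
  · by_contra hcon
    -- Vectors whose output vanishes along the flow on `[0, 1]` form an `A`-invariant set.
    have hzero : ∀ y, P y y ≤ 0 → ∀ t ∈ Set.Icc (0 : ℝ) 1, R (φ t y) (φ t y) = 0 := by
      intro y hy t ht
      by_contra hne
      have := intervalIntegral.integral_pos one_pos (hint y y).continuousOn
        (fun t _ => hnonneg _) ⟨t, ht, lt_of_le_of_ne (hnonneg _) (Ne.symm hne)⟩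
      rw [← hPapp] at this
      linarith
    -- a null vector of a positive semidefinite form lies in its kernel
    have hker : ∀ u, R u u = 0 → ∀ v, R u v = 0 := by
      intro u hu v
      have key : ∀ c : ℝ, 0 ≤ 2 * c * R u v + R v v := fun c => by
        have h := hnonneg (c • u + v)
        simp only [map_add, map_smul, _root_.add_apply, _root_.smul_apply, smul_eq_mul, hu,
          hsymm v u] at h
        linarith
      by_contra hne
      have := key (-(R v v + 1) / (2 * R u v))
      rw [mul_div_assoc', div_mul_eq_mul_div, mul_div_assoc] at this
      field_simp at this
      linarith
    have hinv : ∀ y, (∀ t ∈ Set.Icc (0 : ℝ) 1, R (φ t y) (φ t y) = 0) →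
        ∀ t ∈ Set.Icc (0 : ℝ) 1, R (φ t (A y)) (φ t (A y)) = 0 := by
      intro y hy
      have hall : ∀ v, ∀ t ∈ Set.Ioo (0 : ℝ) 1, R (φ t (A' y)) v = 0 := by
        intro v t ht
        have h1 : HasDerivAt (fun t => φ t y) (φ t (A' y)) t := by
          simpa using (hφd t).clm_apply (hasDerivAt_const t y)
        have h2 := (R.hasFDerivAt.comp_hasDerivAt t h1).clm_apply (hasDerivAt_const t v)
        have h3 : (fun t => R (φ t y) v) =ᶠ[𝓝 t] fun _ => 0 := by
          filter_upwards [Icc_mem_nhds ht.1 ht.2] with s hs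
          exact hker _ (hy s hs) v
        have h4 := (h2.congr_of_eventuallyEq h3.symm).unique (hasDerivAt_const t 0)
        simpa using h4
      have hclosed : ∀ v, ∀ t ∈ Set.Icc (0 : ℝ) 1, R (φ t (A' y)) v = 0 := by
        intro v
        have hc : IsClosed {t : ℝ | R (φ t (A' y)) v = 0} :=
          isClosed_eq (by fun_prop) continuous_const
        have := closure_minimal (s := Set.Ioo (0 : ℝ) 1) (fun t ht => hall v t ht) hc
        rwa [closure_Ioo (by norm_num)] at this
      intro t ht
      have e : φ t (A y) = -(φ t (A' y)) - a • φ t y := by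
        simp [hA']
      have h1 : ∀ v, R (φ t (A y)) v = 0 := fun v => by
        rw [e]
        simp [hclosed v t ht, hker _ (hy t ht) v]
      exact h1 _
    have hpow : ∀ k, ∀ t ∈ Set.Icc (0 : ℝ) 1, R (φ t ((A ^ k) x)) (φ t ((A ^ k) x)) = 0 := by
      intro k
      induction k with
      | zero => simpa using hzero x (not_lt.1 hcon)
      | succ k ih =>
        rw [pow_succ']
        exact hinv _ ih
    refine hx (hobs x fun k => ?_)
    simpa [hφ0] using hpow k 0 (by simp)
  · have h1 : ∫ t in (0 : ℝ)..1, 2 * R (φ t x) (φ t (A' x)) =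
        R (φ 1 x) (φ 1 x) - R (φ 0 x) (φ 0 x) :=
      intervalIntegral.integral_eq_sub_of_hasDerivAt (fun t _ => hderiv x t)
        ((continuous_const.mul (hint _ _)).intervalIntegrable _ _)
    rw [intervalIntegral.integral_const_mul, ← hPapp, hφ0] at h1
    have h2 : P x (A' x) = -P x (A x) - a * P x x := by
      simp [hA']; ring
    have h3 := hnonneg (φ 1 x)
    simp only [one_apply_eq_self] at h1
    linarith



variable {n p : Type*} [Fintype n] [DecidableEq n] [Fintype p]

/-- An observer gain `L = ½ P⁻¹ Cᵀ` built from the Gramian form `P`; the two properties of `P` also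
give decay of `A - c L C` for every `c ≥ 1`. -/
lemma exists_observer_gain (A : Matrix n n ℝ) (C : Matrix p n ℝ)
    (hobs : ∀ x, (∀ k : ℕ, C *ᵥ (A ^ k *ᵥ x) = 0) → x = 0) (a : ℝ) :
    ∃ (P : (n → ℝ) →L[ℝ] (n → ℝ) →L[ℝ] ℝ) (L : Matrix n p ℝ), IsLyapunovForm P ∧
      (∀ x y, P x (L *ᵥ y) = 1 / 2 * ((C *ᵥ x) ⬝ᵥ y)) ∧
      ∀ x, P x (A *ᵥ x) ≤ -a * P x x + 1 / 2 * ((C *ᵥ x) ⬝ᵥ (C *ᵥ x)) := by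
  let R : (n → ℝ) →L[ℝ] (n → ℝ) →L[ℝ] ℝ := LinearMap.toContinuousBilinearMap
    ((dotProductBilin ℝ ℝ).compl₁₂ C.mulVecLin C.mulVecLin)
  have hR : ∀ x y, R x y = (C *ᵥ x) ⬝ᵥ (C *ᵥ y) := fun x y => rfl
  let A' : (n → ℝ) →L[ℝ] (n → ℝ) := LinearMap.toContinuousLinearMap A.mulVecLin
  have hA' : ∀ x, A' x = A *ᵥ x := fun x => rfl
  have hA'k : ∀ (k : ℕ) x, (A' ^ k) x = A ^ k *ᵥ x := fun k => by
    induction k with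
    | zero => simp
    | succ k ih => intro x; rw [pow_succ, pow_succ, mul_apply_eq_comp, ih, hA', mulVec_mulVec]
  obtain ⟨P, hP, hd⟩ := exists_gramian A' R (fun x y => by rw [hR, hR, dotProduct_comm])
    (fun x => by rw [hR]; exact Finset.sum_nonneg fun i _ => mul_self_nonneg _)
    (fun x hx => hobs x fun k => by
      have := hx k
      rwa [hR, dotProduct_self_eq_zero, hA'k] at this) a
  have hinj : Function.Injective (P : (n → ℝ) →ₗ[ℝ] (n → ℝ) →L[ℝ] ℝ) := by
    rw [← LinearMap.ker_eq_bot, LinearMap.ker_eq_bot']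
    intro x hx
    by_contra hne
    have h1 := hP.pos x hne
    have h2 : P x = 0 := hx
    simp [h2] at h1
  have hfin : Module.finrank ℝ (n → ℝ) = Module.finrank ℝ ((n → ℝ) →L[ℝ] ℝ) := by
    rw [← (LinearMap.toContinuousLinearMap (𝕜 := ℝ) (E := n → ℝ) (F' := ℝ)).finrank_eq]
    exact (Subspace.dual_finrank_eq).symm
  have hsurj := (LinearMap.injective_iff_surjective_of_finrank_eq_finrank hfin).1 hinj
  choose l hl using fun j : p => hsurj (LinearMap.toContinuousLinearMap
    ((1 / 2 : ℝ) • (LinearMap.proj j : (p → ℝ) →ₗ[ℝ] ℝ).comp C.mulVecLin))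
  have hl' : ∀ j x, P x (l j) = 1 / 2 * (C *ᵥ x) j := fun j x => by
    rw [hP.symm]
    have := congrArg (fun f : (n → ℝ) →L[ℝ] ℝ => f x) (hl j)
    simpa using this
  refine ⟨P, Matrix.of fun i j => l j i, hP, fun x y => ?_, hd⟩
  have e : (Matrix.of fun i j => l j i) *ᵥ y = ∑ j, y j • l j := by
    ext i
    simp [mulVec, dotProduct, mul_comm]
  rw [e, map_sum, dotProduct, Finset.mul_sum]
  refine Finset.sum_congr rfl fun j _ => ?_
  rw [map_smul, hl', smul_eq_mul]
  ring

lemma exists_decaysAt_sub_mul (A : Matrix n n ℝ) (C : Matrix p n ℝ)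
    (hobs : ∀ x, (∀ k : ℕ, C *ᵥ (A ^ k *ᵥ x) = 0) → x = 0) (a : ℝ) :
    ∃ L : Matrix n p ℝ, DecaysAt (fun (_ : Unit) x => (A - L * C) *ᵥ x) a := by
  obtain ⟨P, L, hP, hL, hd⟩ := exists_observer_gain A C hobs a
  refine ⟨L, P, hP, fun _ x => ?_⟩
  change P x ((A - L * C) *ᵥ x) ≤ _
  rw [sub_mulVec, map_sub, ← mulVec_mulVec, hL]
  linarith [hd x]

/-- If `P` is a Lyapunov form for a matrix, then `P⁻¹` is one for its transpose. -/
lemma DecaysAt.transpose {A : Matrix n n ℝ} {a : ℝ}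
    (h : DecaysAt (fun (_ : Unit) x => A *ᵥ x) a) : DecaysAt (fun (_ : Unit) x => Aᵀ *ᵥ x) a := by
  obtain ⟨P, hP, hd⟩ := h
  -- `T` is the Gram matrix of `P`
  let T : (n → ℝ) →ₗ[ℝ] (n → ℝ) := LinearMap.pi fun j =>
    (LinearMap.applyₗ (Pi.single j (1 : ℝ) : n → ℝ)).comp
      ((ContinuousLinearMap.coeLM ℝ).comp (P : (n → ℝ) →ₗ[ℝ] (n → ℝ) →L[ℝ] ℝ))
  have hT : ∀ x y, T x ⬝ᵥ y = P x y := fun x y => by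
    have e : y = ∑ j, y j • (Pi.single j (1 : ℝ) : n → ℝ) := by
      ext i; simp [Finset.sum_apply, Pi.single_apply]
    conv_rhs => rw [e, map_sum]
    simp only [map_smul, smul_eq_mul, dotProduct]
    exact Finset.sum_congr rfl fun j _ => mul_comm _ _
  have hinj : Function.Injective T := by
    rw [← LinearMap.ker_eq_bot, LinearMap.ker_eq_bot']
    intro x hx
    by_contra hne
    have h1 := hP.pos x hne
    rw [← hT, hx, zero_dotProduct] at h1
    exact lt_irrefl _ h1
  let e : (n → ℝ) ≃L[ℝ] (n → ℝ) :=
    (LinearEquiv.ofInjectiveEndo T hinj).toContinuousLinearEquiv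
  have he : ∀ u, T (e.symm u) = u := fun u => e.apply_symm_apply u
  have hP' : ∀ u v, P (e.symm u) (e.symm v) = u ⬝ᵥ e.symm v := fun u v => by rw [← hT, he]
  refine ⟨P.bilinearComp (e.symm : (n → ℝ) →L[ℝ] (n → ℝ)) (e.symm : (n → ℝ) →L[ℝ] (n → ℝ)),
    ⟨fun x y => hP.symm _ _, fun x hx => hP.pos _ ?_⟩, fun i u => ?_⟩
  · simpa using hx
  · have h1 := hd () (e.symm u)
    simp only [ContinuousLinearMap.bilinearComp_apply, ContinuousLinearEquiv.coe_coe]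
    rw [hP.symm, hP', dotProduct_comm, dotProduct_mulVec, vecMul_transpose, dotProduct_comm]
    rw [hP' u u]
    rwa [← hT, ← hT, he] at h1

lemma exists_decaysAt_add_mul (A : Matrix n n ℝ) (B : Matrix n p ℝ)
    (hctrl : ∀ x, (∀ k : ℕ, Bᵀ *ᵥ (Aᵀ ^ k *ᵥ x) = 0) → x = 0) (a : ℝ) :
    ∃ K : Matrix p n ℝ, DecaysAt (fun (_ : Unit) x => (A + B * K) *ᵥ x) a := by
  obtain ⟨L, hL⟩ := exists_decaysAt_sub_mul Aᵀ Bᵀ hctrl a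
  refine ⟨-Lᵀ, ?_⟩
  have := hL.transpose
  simpa [transpose_sub, transpose_mul, sub_eq_add_neg] using this

end Gramian

lemma injective_mulVec_of_rank {n p : Type*} [Fintype n] [Fintype p] {K : Type*} [Field K]
    {A : Matrix p n K} (h : A.rank = Fintype.card n) (x : n → K) (hx : A *ᵥ x = 0) : x = 0 := by
  have h1 := LinearMap.finrank_range_add_finrank_ker A.mulVecLin
  rw [Module.finrank_fintype_fun_eq_card] at h1
  have h2 : Module.finrank K (LinearMap.range A.mulVecLin) = Fintype.card n := h
  have h3 : LinearMap.ker A.mulVecLin = ⊥ := Submodule.finrank_eq_zero.1 (by omega)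
  exact LinearMap.ker_eq_bot'.1 h3 x hx

lemma IsObservable.eq_zero {n q : ℕ} {C : Matrix (Fin q) (Fin n) ℝ} {A : Matrix (Fin n) (Fin n) ℝ}
    (h : IsObservable C A) (x : Fin n → ℝ) (hx : ∀ k : ℕ, C *ᵥ (A ^ k *ᵥ x) = 0) : x = 0 := by
  refine injective_mulVec_of_rank (h.trans (Fintype.card_fin n).symm) x ?_
  ext ⟨k, i⟩
  have := congrFun (hx k) i
  rw [mulVec_mulVec] at this
  exact this

lemma IsControllable.eq_zero {n p : ℕ} {A : Matrix (Fin n) (Fin n) ℝ}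
    {B : Matrix (Fin n) (Fin p) ℝ} (h : IsControllable A B) (x : Fin n → ℝ)
    (hx : ∀ k : ℕ, Bᵀ *ᵥ (Aᵀ ^ k *ᵥ x) = 0) : x = 0 := by
  unfold IsControllable at h
  rw [← rank_transpose] at h
  refine injective_mulVec_of_rank (h.trans (Fintype.card_fin n).symm) x ?_
  ext ⟨k, i⟩
  have := congrFun (hx k) i
  rw [mulVec_mulVec, ← transpose_pow, ← transpose_mul] at this
  exact this

/-! ### The Hautus test -/

section Hautus

/-- The Hautus test over `ℂ`: a nonzero unobservable subspace is invariant, so it contains an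
eigenvector. -/
lemma eq_zero_of_forall_apply_pow_eq_zero {V Y : Type*} [AddCommGroup V] [Module ℂ V]
    [FiniteDimensional ℂ V] [AddCommGroup Y] [Module ℂ Y] (f : Module.End ℂ V) (c : V →ₗ[ℂ] Y)
    (h : ∀ (lam : ℂ) z, f z = lam • z → c z = 0 → z = 0) (z : V)
    (hz : ∀ k : ℕ, c ((f ^ k) z) = 0) : z = 0 := by
  -- the unobservable subspace
  let U : Submodule ℂ V := ⨅ k : ℕ, LinearMap.ker (c.comp (f ^ k))
  have hU : ∀ y, y ∈ U ↔ ∀ k : ℕ, c ((f ^ k) y) = 0 := fun y => by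
    simp [U, Submodule.mem_iInf]
  have hinv : ∀ y ∈ U, f y ∈ U := fun y hy => (hU _).2 fun k => by
    have := (hU _).1 hy (k + 1)
    rwa [pow_succ] at this
  by_contra hne
  have : Nontrivial U := ⟨⟨⟨z, (hU z).2 hz⟩, 0, fun h0 => hne (congrArg Subtype.val h0)⟩⟩
  obtain ⟨lam, hlam⟩ := Module.End.exists_eigenvalue (f.restrict hinv)
  obtain ⟨y, hy⟩ := hlam.exists_hasEigenvector
  have h1 := congrArg Subtype.val hy.apply_eq_smul
  have h2 := (hU _).1 y.2 0
  exact hy.2 (Subtype.ext (h lam y h1 h2))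

variable {n p : Type*} [Fintype n]

lemma map_ofReal_mulVec_re (A : Matrix p n ℝ) (z : n → ℂ) (i : p) :
    ((A.map Complex.ofReal *ᵥ z) i).re = (A *ᵥ fun j => (z j).re) i := by
  simp [mulVec, dotProduct]

lemma map_ofReal_mulVec_im (A : Matrix p n ℝ) (z : n → ℂ) (i : p) :
    ((A.map Complex.ofReal *ᵥ z) i).im = (A *ᵥ fun j => (z j).im) i := by
  simp [mulVec, dotProduct]

lemma map_ofReal_pow [DecidableEq n] (A : Matrix n n ℝ) (k : ℕ) :
    A.map Complex.ofReal ^ k = (A ^ k).map Complex.ofReal :=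
  (map_pow (Complex.ofRealHom.mapMatrix) A k).symm

/-- The Hautus test for a real pair `(C, A)`, with eigenvectors over `ℂ`. -/
lemma eq_zero_of_hautus [DecidableEq n] {A : Matrix n n ℝ} {C : Matrix p n ℝ}
    (h : ∀ (lam : ℂ) z, A.map Complex.ofReal *ᵥ z = lam • z → C.map Complex.ofReal *ᵥ z = 0 →
      z = 0) (x : n → ℝ) (hx : ∀ k : ℕ, C *ᵥ (A ^ k *ᵥ x) = 0) : x = 0 := by
  have h1 := eq_zero_of_forall_apply_pow_eq_zero (Matrix.toLin' (A.map Complex.ofReal))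
    (C.map Complex.ofReal).mulVecLin (fun lam z hz => by
      simpa using h lam z (by simpa using hz)) (fun i => (x i : ℂ)) fun k => by
      rw [← Matrix.toLin'_pow, map_ofReal_pow, Matrix.toLin'_apply, mulVecLin_apply,
        mulVec_mulVec]
      have e : C.map Complex.ofReal * (A ^ k).map Complex.ofReal
          = (C * A ^ k).map Complex.ofReal := (Matrix.map_mul (f := Complex.ofRealHom)).symm
      rw [e]
      have hk := hx k
      rw [mulVec_mulVec] at hk
      ext i
      apply Complex.ext
      · rw [map_ofReal_mulVec_re]; simp [hk]
      · rw [map_ofReal_mulVec_im]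
        exact congrFun (mulVec_zero _) i
  ext i
  simpa using congrFun h1 i

/-- Converse of the Hautus test: the real and imaginary parts of an eigenvector in the kernel of `C`
are unobservable. -/
lemma hautus_of_eq_zero [DecidableEq n] {A : Matrix n n ℝ} {C : Matrix p n ℝ}
    (h : ∀ x, (∀ k : ℕ, C *ᵥ (A ^ k *ᵥ x) = 0) → x = 0) (lam : ℂ) (z : n → ℂ)
    (hz : A.map Complex.ofReal *ᵥ z = lam • z) (hCz : C.map Complex.ofReal *ᵥ z = 0) :
    z = 0 := by
  have hpow : ∀ k : ℕ, (A ^ k).map Complex.ofReal *ᵥ z = lam ^ k • z := fun k => by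
    rw [← map_ofReal_pow]
    induction k with
    | zero => simp
    | succ k ih => rw [pow_succ, ← mulVec_mulVec, hz, mulVec_smul, ih, smul_smul, pow_succ']
  have hC : ∀ k : ℕ, (C * A ^ k).map Complex.ofReal *ᵥ z = 0 := fun k => by
    have e : C.map Complex.ofReal * (A ^ k).map Complex.ofReal
        = (C * A ^ k).map Complex.ofReal := (Matrix.map_mul (f := Complex.ofRealHom)).symm
    rw [← e, ← mulVec_mulVec, hpow, mulVec_smul, hCz, smul_zero]
  have hre := h (fun j => (z j).re) fun k => by
    ext i
    rw [mulVec_mulVec, ← map_ofReal_mulVec_re, hC]; simp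
  have him := h (fun j => (z j).im) fun k => by
    ext i
    rw [mulVec_mulVec, ← map_ofReal_mulVec_im, hC]; simp
  ext j
  exact Complex.ext (congrFun hre j) (congrFun him j)

end Hautus

/-! ### The internal model -/

namespace MultiAgentSystem

variable {N q m : ℕ} (M : MultiAgentSystem N q m)

lemma minpoly_monic : (minpoly ℝ M.S).Monic :=
  minpoly.monic (Algebra.IsIntegral.isIntegral (R := ℝ) M.S)

lemma G1_apply (j j' : Fin q) (k l : Fin M.pm) :
    M.G1 (j, k) (j', l) = if j = j' then M.beta k l else 0 := by
  simp [G1, kroneckerMap_apply, one_apply]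

lemma G2_apply (j j' : Fin q) (k : Fin M.pm) :
    M.G2 (j, k) j' = if j = j' then M.gamma k () else 0 := by
  simp [G2, kroneckerMap_apply, one_apply]

lemma G1_mulVec (w : Fin q × Fin M.pm → ℝ) (j : Fin q) (k : Fin M.pm) :
    (M.G1 *ᵥ w) (j, k) = ∑ l, M.beta k l * w (j, l) := by
  simp only [mulVec, dotProduct, Fintype.sum_prod_type, G1_apply, ite_mul, zero_mul]
  rw [Finset.sum_comm]
  simp

lemma G2_mulVec (y : Fin q → ℝ) (j : Fin q) (k : Fin M.pm) :
    (M.G2 *ᵥ y) (j, k) = M.gamma k () * y j := by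
  simp [mulVec, dotProduct, G2_apply]

lemma G1_transpose_mulVec (w : Fin q × Fin M.pm → ℂ) (j : Fin q) (l : Fin M.pm) :
    (M.G1ᵀ.map Complex.ofReal *ᵥ w) (j, l) = ∑ k, (M.beta k l : ℂ) * w (j, k) := by
  simp only [mulVec, dotProduct, Fintype.sum_prod_type, map_apply, transpose_apply, G1_apply]
  rw [Finset.sum_comm]
  simp [apply_ite Complex.ofReal]

lemma G2_transpose_mulVec (w : Fin q × Fin M.pm → ℂ) (j : Fin q) :
    (M.G2ᵀ.map Complex.ofReal *ᵥ w) j = ∑ k, (M.gamma k () : ℂ) * w (j, k) := by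
  simp only [mulVec, dotProduct, Fintype.sum_prod_type, map_apply, transpose_apply, G2_apply]
  rw [Finset.sum_comm]
  simp [apply_ite Complex.ofReal]

variable {M}

/-- A left eigenvector of the companion matrix is determined by its last entry. -/
lemma eq_zero_of_beta_left_eigenvector {lam : ℂ} {w : Fin M.pm → ℂ}
    (h : ∀ l, ∑ k, (M.beta k l : ℂ) * w k = lam * w l)
    (h0 : ∑ k, (M.gamma k () : ℂ) * w k = 0) : w = 0 := by
  have hlast : ∀ l : Fin M.pm, (l : ℕ) + 1 = M.pm → w l = 0 := fun l hl => by
    rw [Finset.sum_eq_single l] at h0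
    · simpa [gamma, hl] using h0
    · intro k _ hk
      have : ¬ (k : ℕ) + 1 = M.pm := fun h => hk (Fin.ext (by omega))
      simp [gamma, this]
    · simp
  have key : ∀ d : ℕ, ∀ l : Fin M.pm, (l : ℕ) + d + 1 = M.pm → w l = 0 := by
    intro d
    induction d with
    | zero => exact fun l hl => hlast l (by omega)
    | succ d ih =>
      intro l hl
      have h1 := h ⟨l + 1, by omega⟩
      rw [ih ⟨l + 1, by omega⟩ (by simp only; omega), mul_zero, Finset.sum_eq_single l] at h1
      · have h2 : (l : ℕ) + 1 < M.pm := by omega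
        simpa [beta, h2] using h1
      · intro k _ hk
        by_cases hk1 : (k : ℕ) + 1 < M.pm
        · have h3 : (l : ℕ) ≠ k := fun h => hk (Fin.ext h.symm)
          simp [beta, hk1, h3]
        · rw [hlast k (by omega), mul_zero]
      · simp
  ext l
  exact key (M.pm - 1 - l) l (by omega)

/-- Pairing a left eigenvector of the companion matrix with `(1, λ, λ², …)`, an eigenvector up to
the value of the minimal polynomial at `λ`. -/
lemma aeval_minpoly_mul_eq_zero {lam : ℂ} {w : Fin M.pm → ℂ}
    (h : ∀ l, ∑ k, (M.beta k l : ℂ) * w k = lam * w l) :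
    Polynomial.aeval lam (minpoly ℝ M.S) * ∑ k, (M.gamma k () : ℂ) * w k = 0 := by
  set p := minpoly ℝ M.S with hp
  have haev : Polynomial.aeval lam p
      = ∑ l : Fin M.pm, (p.coeff l : ℂ) * lam ^ (l : ℕ) + lam ^ M.pm := by
    rw [Polynomial.aeval_eq_sum_range, Finset.sum_range_succ, M.minpoly_monic.coeff_natDegree,
      Finset.sum_range]
    simp [pm, hp]
    rfl
  have hu : ∀ k : Fin M.pm, ∑ l : Fin M.pm, (M.beta k l : ℂ) * lam ^ (l : ℕ)
      = lam * lam ^ (k : ℕ) - Polynomial.aeval lam p * (M.gamma k () : ℂ) := by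
    intro k
    by_cases hk : (k : ℕ) + 1 < M.pm
    · have hk' : (k : ℕ) + 1 ≠ M.pm := by omega
      rw [Finset.sum_eq_single ⟨k + 1, hk⟩]
      · simp [beta, gamma, hk, hk', pow_succ']
      · intro l _ hl
        have : (l : ℕ) ≠ k + 1 := fun h => hl (Fin.ext h)
        simp [beta, hk, this]
      · simp
    · have hk' : (k : ℕ) + 1 = M.pm := by omega
      rw [haev, ← pow_succ', hk']
      simp [beta, gamma, hk', hp]
  have h1 : ∑ l, (∑ k, (M.beta k l : ℂ) * w k) * lam ^ (l : ℕ)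
      = ∑ k, w k * ∑ l : Fin M.pm, (M.beta k l : ℂ) * lam ^ (l : ℕ) := by
    simp only [Finset.sum_mul, Finset.mul_sum]
    rw [Finset.sum_comm]
    exact Finset.sum_congr rfl fun _ _ => Finset.sum_congr rfl fun _ _ => by ring
  simp only [h, hu, mul_sub, Finset.sum_sub_distrib] at h1
  have h2 : ∑ l, lam * w l * lam ^ (l : ℕ) = ∑ k, w k * (lam * lam ^ (k : ℕ)) :=
    Finset.sum_congr rfl fun _ _ => by ring
  rw [h2, eq_comm, sub_eq_self] at h1
  rw [Finset.mul_sum, ← h1]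
  exact Finset.sum_congr rfl fun _ _ => by ring

lemma hasEigenvalue_of_aeval_minpoly {lam : ℂ}
    (h : Polynomial.aeval lam (minpoly ℝ M.S) = 0) :
    Module.End.HasEigenvalue (Matrix.toLin' (M.S.map Complex.ofReal)) lam := by
  rw [Module.End.hasEigenvalue_iff_mem_spectrum, Matrix.spectrum_toLin',
    Matrix.mem_spectrum_iff_isRoot_charpoly]
  have h1 : (M.S.map Complex.ofReal).charpoly = M.S.charpoly.map Complex.ofRealHom :=
    Matrix.charpoly_map M.S Complex.ofRealHom
  rw [h1, Polynomial.IsRoot, Polynomial.eval_map]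
  obtain ⟨g, hg⟩ := Matrix.minpoly_dvd_charpoly M.S
  have h2 : Polynomial.aeval lam M.S.charpoly = 0 := by
    rw [hg, map_mul, h, zero_mul]
  exact h2

variable (M) in
/-- The state matrix of follower `i` augmented by the internal model. -/
noncomputable def augA (i : Fin N) :
    Matrix (Fin (M.n i) ⊕ (Fin q × Fin M.pm)) (Fin (M.n i) ⊕ (Fin q × Fin M.pm)) ℝ :=
  fromBlocks (M.A i) 0 (M.G2 * M.C i) M.G1

variable (M) in
/-- The input matrix of follower `i` augmented by the internal model. -/
noncomputable def augB (i : Fin N) :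
    Matrix (Fin (M.n i) ⊕ (Fin q × Fin M.pm)) (Fin (M.p i)) ℝ :=
  fromRows (M.B i) (M.G2 * M.D i)

/-- The augmented pair is controllable: at a mode of the internal model, which is an eigenvalue of
`S`, this is the transmission zero condition; elsewhere it is controllability of `(A, B)`. -/
lemma augmented_controllable (htrans : M.TransmissionZeroCondition) {i : Fin N}
    (hctrl : IsControllable (M.A i) (M.B i)) (x : Fin (M.n i) ⊕ (Fin q × Fin M.pm) → ℝ)
    (hx : ∀ k : ℕ, (M.augB i)ᵀ *ᵥ ((M.augA i)ᵀ ^ k *ᵥ x) = 0) : x = 0 := by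
  refine eq_zero_of_hautus (fun lam z hz hBz => ?_) x hx
  obtain ⟨a, w, rfl⟩ : ∃ a w, z = Sum.elim a w := ⟨z ∘ Sum.inl, z ∘ Sum.inr, by simp⟩
  have hmul : ∀ {r : Type} (X : Matrix (Fin q) r ℝ) , ((M.G2 * X)ᵀ.map Complex.ofReal) *ᵥ w
      = Xᵀ.map Complex.ofReal *ᵥ (M.G2ᵀ.map Complex.ofReal *ᵥ w) := fun X => by
    rw [mulVec_mulVec, transpose_mul]
    congr 1
    exact Matrix.map_mul (f := Complex.ofRealHom)
  simp only [augA, fromBlocks_transpose, fromBlocks_map, fromBlocks_mulVec, Sum.elim_comp_inl,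
    Sum.elim_comp_inr] at hz
  have hz1 : (M.A i)ᵀ.map Complex.ofReal *ᵥ a + (M.C i)ᵀ.map Complex.ofReal *ᵥ
      (M.G2ᵀ.map Complex.ofReal *ᵥ w) = lam • a := by
    rw [← hmul]
    ext k
    simpa using congrFun hz (Sum.inl k)
  have hz2 : ∀ j l, ∑ k, (M.beta k l : ℂ) * w (j, k) = lam * w (j, l) := fun j l => by
    rw [← G1_transpose_mulVec]
    simpa using congrFun hz (Sum.inr (j, l))
  have hz3 : (M.B i)ᵀ.map Complex.ofReal *ᵥ a + (M.D i)ᵀ.map Complex.ofReal *ᵥ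
      (M.G2ᵀ.map Complex.ofReal *ᵥ w) = 0 := by
    rw [← hmul, ← hBz]
    ext k
    simp [augB, mulVec, dotProduct, -transpose_mul]
  set r := M.G2ᵀ.map Complex.ofReal *ᵥ w with hr
  have hr0 : r = 0 := by
    by_contra hne
    obtain ⟨j, hj⟩ := Function.ne_iff.1 hne
    have h1 := aeval_minpoly_mul_eq_zero (hz2 j)
    rw [← G2_transpose_mulVec, ← hr] at h1
    have hrank := htrans lam (hasEigenvalue_of_aeval_minpoly
      ((mul_eq_zero.1 h1).resolve_right hj)) i
    rw [← rank_transpose] at hrank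
    have h2 := injective_mulVec_of_rank (hrank.trans (by simp)) (Sum.elim a r) (by
      simp only [fromBlocks_transpose, fromBlocks_mulVec, Sum.elim_comp_inl, Sum.elim_comp_inr,
        transpose_sub, transpose_smul, transpose_one, sub_mulVec, smul_mulVec,
        one_mulVec]
      rw [← transpose_map, ← transpose_map, ← transpose_map, ← transpose_map, hz3,
        sub_add_eq_add_sub, hz1, sub_self]
      ext k
      cases k <;> rfl)
    exact hne (funext fun k => congrFun h2 (Sum.inr k))
  have hw : w = 0 := by
    ext ⟨j, k⟩
    have h1 := eq_zero_of_beta_left_eigenvector (hz2 j) (by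
      rw [← G2_transpose_mulVec, ← hr, hr0]; rfl)
    exact congrFun h1 k
  have ha : a = 0 := hautus_of_eq_zero (fun x hx => hctrl.eq_zero x hx) lam a
    (by simpa [hr0] using hz1) (by simpa [hr0] using hz3)
  rw [ha, hw]
  ext k
  cases k <;> rfl

/-- The internal model principle: a steady state of the internal model forces its input to
vanish. Along a steady state the `k`-th component is the first one composed with `S ^ k`, so the
input is the first component composed with the minimal polynomial of `S` at `S`. -/
lemma internalModel_input_eq_zero {X : (Fin m → ℝ) →ₗ[ℝ] (Fin q × Fin M.pm → ℝ)}
    {Y : (Fin m → ℝ) →ₗ[ℝ] (Fin q → ℝ)}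
    (h : ∀ v, X (M.S *ᵥ v) = M.G1 *ᵥ X v + M.G2 *ᵥ Y v) (v : Fin m → ℝ) : Y v = 0 := by
  have hmin : Polynomial.aeval M.S (minpoly ℝ M.S) = 0 := minpoly.aeval _ _
  ext j
  have hjk : ∀ (k : Fin M.pm) v, X (M.S *ᵥ v) (j, k)
      = ∑ l, M.beta k l * X v (j, l) + M.gamma k () * Y v j := fun k v => by
    rw [h, Pi.add_apply, G1_mulVec, G2_mulVec]
  rcases Nat.eq_zero_or_pos M.pm with h0 | hpos
  · have h1 : minpoly ℝ M.S = 1 := M.minpoly_monic.natDegree_eq_zero.1 h0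
    rw [h1, map_one] at hmin
    have : v = 0 := by rw [← one_mulVec v, hmin, zero_mulVec]
    simp [this]
  · have hchain : ∀ k : ℕ, ∀ hk : k < M.pm, ∀ v,
        X v (j, ⟨k, hk⟩) = X (M.S ^ k *ᵥ v) (j, ⟨0, hpos⟩) := by
      intro k
      induction k with
      | zero => intro hk v; simp
      | succ k ih =>
        intro hk v
        rw [pow_succ, ← mulVec_mulVec, ← ih (by omega), hjk, Finset.sum_eq_single ⟨k + 1, hk⟩]
        · have : k + 1 ≠ M.pm := by omega
          simp [beta, gamma, hk, this]
        · intro l _ hl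
          have : (l : ℕ) ≠ k + 1 := fun h => hl (Fin.ext h)
          simp [beta, hk, this]
        · simp
    have hlast := hjk ⟨M.pm - 1, by omega⟩ v
    have e : M.pm - 1 + 1 = M.pm := by omega
    rw [hchain, mulVec_mulVec, ← pow_succ, e] at hlast
    have hsum : ∑ l : Fin M.pm, (minpoly ℝ M.S).coeff l * X (M.S ^ (l : ℕ) *ᵥ v) (j, ⟨0, hpos⟩)
        + X (M.S ^ M.pm *ᵥ v) (j, ⟨0, hpos⟩) = 0 := by
      have h1 : X (Polynomial.aeval M.S (minpoly ℝ M.S) *ᵥ v) (j, ⟨0, hpos⟩) = 0 := by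
        rw [hmin, zero_mulVec, map_zero]; rfl
      rw [Polynomial.aeval_eq_sum_range, Finset.sum_range_succ, M.minpoly_monic.coeff_natDegree,
        Finset.sum_range, one_smul, add_mulVec, sum_mulVec] at h1
      simp only [map_add, map_sum, map_smul, smul_mulVec, Pi.add_apply, Finset.sum_apply,
        Pi.smul_apply, smul_eq_mul] at h1
      exact h1
    have hβ : ∀ l : Fin M.pm, M.beta ⟨M.pm - 1, by omega⟩ l = -(minpoly ℝ M.S).coeff l :=
      fun l => by simp [beta, e]
    have hγ : M.gamma ⟨M.pm - 1, by omega⟩ () = 1 := by simp [gamma, e]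
    have hX : ∀ l : Fin M.pm, X v (j, l) = X (M.S ^ (l : ℕ) *ᵥ v) (j, ⟨0, hpos⟩) :=
      fun l => hchain l l.2 v
    simp only [hβ, hγ, hX, one_mul, neg_mul, Finset.sum_neg_distrib] at hlast
    simp only [Pi.zero_apply]
    linarith

end MultiAgentSystem

/-! ### The distributed observer of the leader -/

namespace CommGraph

variable {N : ℕ}

/-- The quadratic form `∑ᵢ zᵢ ∑ⱼ aᵢⱼ (zᵢ - zⱼ)`, with `z₀ = 0` at the leader, of the Laplacian
grounded at the leader. -/
def energy (G : CommGraph N) (z : Fin N → ℝ) : ℝ :=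
  ∑ i : Fin N, z i * ∑ j : Fin (N + 1),
    G.weight i.succ j * (z i - (Fin.cons 0 z : Fin (N + 1) → ℝ) j)

lemma energy_eq {G : CommGraph N} (hG : G.IsConnected) (z : Fin N → ℝ) :
    G.energy z = ∑ i : Fin N, G.weight i.succ 0 * z i ^ 2
      + 1 / 2 * ∑ i : Fin N, ∑ j : Fin N, G.weight i.succ j.succ * (z i - z j) ^ 2 := by
  have hswap : ∑ i : Fin N, ∑ j : Fin N, G.weight i.succ j.succ * (z i * (z i - z j))
      = ∑ i : Fin N, ∑ j : Fin N, G.weight i.succ j.succ * (z j * (z j - z i)) := by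
    rw [Finset.sum_comm]
    exact Finset.sum_congr rfl fun i _ => Finset.sum_congr rfl fun j _ => by rw [hG.2 j i]
  have hsum : ∑ i : Fin N, ∑ j : Fin N, G.weight i.succ j.succ * (z i - z j) ^ 2
      = ∑ i : Fin N, ∑ j : Fin N, G.weight i.succ j.succ * (z i * (z i - z j))
        + ∑ i : Fin N, ∑ j : Fin N, G.weight i.succ j.succ * (z j * (z j - z i)) := by
    simp only [← Finset.sum_add_distrib]
    exact Finset.sum_congr rfl fun i _ => Finset.sum_congr rfl fun j _ => by ring
  have hE : G.energy z = ∑ i : Fin N, G.weight i.succ 0 * z i ^ 2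
      + ∑ i : Fin N, ∑ j : Fin N, G.weight i.succ j.succ * (z i * (z i - z j)) := by
    rw [energy, ← Finset.sum_add_distrib]
    refine Finset.sum_congr rfl fun i _ => ?_
    rw [Fin.sum_univ_succ, mul_add, Finset.mul_sum]
    simp only [Fin.cons_zero, Fin.cons_succ]
    congr 1
    · ring
    · exact Finset.sum_congr rfl fun j _ => by ring
  rw [hE, hsum, ← hswap]
  ring

lemma energy_nonneg {G : CommGraph N} (hG : G.IsConnected) (z : Fin N → ℝ) :
    0 ≤ G.energy z := by
  rw [energy_eq hG]
  have h1 : 0 ≤ ∑ i : Fin N, G.weight i.succ 0 * z i ^ 2 :=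
    Finset.sum_nonneg fun i _ => mul_nonneg (G.weight_nonneg _ _) (sq_nonneg _)
  have h2 : 0 ≤ ∑ i : Fin N, ∑ j : Fin N, G.weight i.succ j.succ * (z i - z j) ^ 2 :=
    Finset.sum_nonneg fun i _ => Finset.sum_nonneg fun j _ =>
      mul_nonneg (G.weight_nonneg _ _) (sq_nonneg _)
  linarith

/-- The energy vanishes only if `z` is constant along every arc, hence equal to the value `0` at the
leader. -/
lemma energy_pos {G : CommGraph N} (hG : G.IsConnected) {z : Fin N → ℝ} (hz : z ≠ 0) :
    0 < G.energy z := by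
  refine lt_of_le_of_ne (energy_nonneg hG z) fun h0 => hz ?_
  have hn1 : ∀ i ∈ Finset.univ, 0 ≤ G.weight (Fin.succ i) 0 * z i ^ 2 :=
    fun i _ => mul_nonneg (G.weight_nonneg _ _) (sq_nonneg _)
  have hn3 : ∀ i, ∀ j ∈ Finset.univ,
      0 ≤ G.weight (Fin.succ i) (Fin.succ j) * (z i - z j) ^ 2 :=
    fun i j _ => mul_nonneg (G.weight_nonneg _ _) (sq_nonneg _)
  have hn2 : ∀ i ∈ Finset.univ, 0 ≤ ∑ j, G.weight (Fin.succ i) (Fin.succ j) * (z i - z j) ^ 2 :=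
    fun i _ => Finset.sum_nonneg (hn3 i)
  have h1 := Finset.sum_nonneg hn1
  have h2 := Finset.sum_nonneg hn2
  rw [energy_eq hG] at h0
  have e1 := (Finset.sum_eq_zero_iff_of_nonneg hn1).1 (by linarith)
  have e2 := (Finset.sum_eq_zero_iff_of_nonneg hn2).1 (by linarith)
  have key : ∀ i, Relation.ReflTransGen (fun j k => 0 < G.weight k j) 0 i →
      (Fin.cons 0 z : Fin (N + 1) → ℝ) i = 0 := by
    intro i hi
    induction hi with
    | refl => rfl
    | @tail j k _ hjk ih =>
      cases k using Fin.cases with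
      | zero => rfl
      | succ k =>
        cases j using Fin.cases with
        | zero =>
          have := e1 k (Finset.mem_univ _)
          simpa [hjk.ne'] using this
        | succ j =>
          have := (Finset.sum_eq_zero_iff_of_nonneg (hn3 k)).1 (e2 k (Finset.mem_univ _)) j
            (Finset.mem_univ _)
          have h3 : z k - z j = 0 := by simpa [hjk.ne'] using this
          simp only [Fin.cons_succ] at ih ⊢
          linarith
  ext i
  simpa using key i.succ (hG.1 _)

lemma exists_sum_sq_le_energy {κ : ℕ} {G : Fin κ → CommGraph N} (hG : ∀ k, (G k).IsConnected) :
    ∃ μ : ℝ, ∀ k (z : Fin N → ℝ), ∑ i, z i ^ 2 ≤ μ * (G k).energy z := by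
  have h : ∀ k, ∃ K : ℝ, 0 < K ∧ ∀ z : Fin N → ℝ, ∑ i, z i ^ 2 ≤ K * (G k).energy z := fun k =>
    exists_le_mul_of_homogeneous (by fun_prop)
      ((continuous_congr fun z => energy_eq (hG k) z).2 (by fun_prop))
      (fun c x => by simp [mul_pow, Finset.mul_sum])
      (fun c x => by
        rw [energy_eq (hG k), energy_eq (hG k), mul_add, mul_left_comm]
        simp only [Pi.smul_apply, smul_eq_mul, Finset.mul_sum]
        congr 1
        · exact Finset.sum_congr rfl fun i _ => by ring
        · exact Finset.sum_congr rfl fun i _ => Finset.sum_congr rfl fun j _ => by ring)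
      fun z hz => energy_pos (hG k) hz
  choose K hK hle using h
  refine ⟨∑ k, K k, fun k z => (hle k z).trans ?_⟩
  exact mul_le_mul_of_nonneg_right
    (Finset.single_le_sum (f := K) (fun k _ => (hK k).le) (Finset.mem_univ k))
    (energy_nonneg (hG k) z)

end CommGraph

namespace MultiAgentSystem

variable {N q m : ℕ} (M : MultiAgentSystem N q m)

/-- The vector field of the observer errors `ηᵢ - v`. -/
noncomputable def observerError (L₀ : Matrix (Fin m) (Fin q) ℝ) (G : CommGraph N)
    (η : Fin N → Fin m → ℝ) (i : Fin N) : Fin m → ℝ :=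
  M.S *ᵥ η i - L₀ *ᵥ (M.F *ᵥ ∑ j : Fin (N + 1), G.weight i.succ j •
    (η i - (Fin.cons 0 η : Fin (N + 1) → Fin m → ℝ) j))

variable {M}

/-- The form `∑ᵢ P ηᵢ ηᵢ`, with the Gramian form `P` of `(F, S)`, is a common Lyapunov function for
all graphs once the gain `½ P⁻¹ Fᵀ` is scaled to dominate the inverse of the least eigenvalue of all
the grounded Laplacians. -/
lemma exists_decaysAt_observerError {κ : ℕ} {G : Fin κ → CommGraph N}
    (hG : ∀ k, (G k).IsConnected) (hobs : IsObservable M.F M.S) (a : ℝ) :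
    ∃ L₀, DecaysAt (fun k => M.observerError L₀ (G k)) a := by
  obtain ⟨P, L, hP, hL, hd⟩ := exists_observer_gain M.S M.F (fun x hx => hobs.eq_zero x hx) a
  obtain ⟨μ, hμ⟩ := CommGraph.exists_sum_sq_le_energy hG
  let pr : Fin N → (Fin N → Fin m → ℝ) →L[ℝ] (Fin m → ℝ) := fun i => ContinuousLinearMap.proj i
  have happ : ∀ x y, (∑ i, P.bilinearComp (pr i) (pr i)) x y = ∑ i, P (x i) (y i) := fun x y => by
    simp [pr]
  refine ⟨μ • L, ∑ i, P.bilinearComp (pr i) (pr i), ⟨fun x y => ?_, fun x hx => ?_⟩,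
    fun k η => ?_⟩
  · simp only [happ, hP.symm]
  · rw [happ]
    obtain ⟨i, hi⟩ := Function.ne_iff.1 hx
    exact Finset.sum_pos' (fun i _ => hP.nonneg _) ⟨i, Finset.mem_univ _, hP.pos _ hi⟩
  · rw [happ, happ]
    set s : Fin N → Fin m → ℝ := fun i => ∑ j : Fin (N + 1), (G k).weight i.succ j •
      (η i - (Fin.cons 0 η : Fin (N + 1) → Fin m → ℝ) j) with hs
    have hterm : ∀ i, P (η i) (M.observerError (μ • L) (G k) η i) ≤ -a * P (η i) (η i)
        + 1 / 2 * ((M.F *ᵥ η i) ⬝ᵥ (M.F *ᵥ η i)) - μ * (1 / 2 * ((M.F *ᵥ η i) ⬝ᵥ (M.F *ᵥ s i))) :=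
      fun i => by
        rw [observerError, map_sub, smul_mulVec, map_smul, hL, smul_eq_mul]
        linarith [hd (η i)]
    have hFs : ∀ i c, (M.F *ᵥ s i) c = ∑ j : Fin (N + 1), (G k).weight i.succ j *
        ((M.F *ᵥ η i) c - (Fin.cons 0 (fun i => (M.F *ᵥ η i) c) : Fin (N + 1) → ℝ) j) := by
      intro i c
      simp only [hs, mulVec_sum, mulVec_smul, mulVec_sub, Finset.sum_apply, Pi.smul_apply,
        Pi.sub_apply, smul_eq_mul]
      refine Finset.sum_congr rfl fun j _ => ?_
      cases j using Fin.cases with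
      | zero => simp
      | succ j => simp
    have hkey : ∑ i, (M.F *ᵥ η i) ⬝ᵥ (M.F *ᵥ η i) ≤ μ * ∑ i, (M.F *ᵥ η i) ⬝ᵥ (M.F *ᵥ s i) := by
      simp only [dotProduct, hFs]
      rw [Finset.sum_comm, Finset.sum_comm (γ := Fin N), Finset.mul_sum]
      refine Finset.sum_le_sum fun c _ => ?_
      have := hμ k fun i => (M.F *ᵥ η i) c
      simpa only [pow_two, CommGraph.energy] using this
    calc _ ≤ _ := Finset.sum_le_sum fun i _ => hterm i
      _ = -a * ∑ i, P (η i) (η i) + 1 / 2 * (∑ i, (M.F *ᵥ η i) ⬝ᵥ (M.F *ᵥ η i)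
          - μ * ∑ i, (M.F *ᵥ η i) ⬝ᵥ (M.F *ᵥ s i)) := by
        simp only [Finset.sum_sub_distrib, Finset.sum_add_distrib, Finset.mul_sum, mul_sub]
        rw [add_sub_assoc]
        congr 2
        exact Finset.sum_congr rfl fun _ _ => by ring
      _ ≤ _ := by linarith

end MultiAgentSystem

/-! ### Existence of solutions of switched linear systems -/

/-- The solution of a switched linear system, glued from exponentials between the switching
instants. -/
lemma exists_switched_solution {E : Type*} [NormedAddCommGroup E] [NormedSpace ℝ E]
    [CompleteSpace E] {κ : ℕ} {σ : ℝ → Fin κ} (hσ : IsSwitchingSignal σ) (A : Fin κ → E →L[ℝ] E)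
    (z₀ : E) : ∃ z : ℝ → E, z 0 = z₀ ∧ ContinuousOn z (Set.Ici 0) ∧
      ∀ t, 0 ≤ t → HasDerivWithinAt z (A (σ t) (z t)) (Set.Ici t) t := by
  obtain ⟨τ, hτ, t, ht0, hdwell, hconst⟩ := hσ
  have hmono : StrictMono t := strictMono_nat_of_lt_succ fun k => by linarith [hdwell k]
  have hlow : ∀ k : ℕ, k * τ ≤ t k := fun k => by
    induction k with
    | zero => simp [ht0]
    | succ k ih => push_cast; linarith [hdwell k]
  have hex : ∀ s : ℝ, ∃ k : ℕ, s < t (k + 1) := fun s => by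
    obtain ⟨k, hk⟩ := exists_nat_gt (s / τ)
    refine ⟨k, lt_of_lt_of_le ?_ (hlow (k + 1))⟩
    rw [div_lt_iff₀ hτ] at hk
    push_cast
    linarith
  classical
  -- the index of the interval that contains `s`
  let I : ℝ → ℕ := fun s => Nat.find (hex s)
  have hI : ∀ k, ∀ s ∈ Set.Ico (t k) (t (k + 1)), I s = k := fun k s hs => by
    refine (Nat.find_eq_iff _).2 ⟨hs.2, fun j hj => ?_⟩
    have : t (j + 1) ≤ t k := hmono.monotone hj
    linarith [hs.1]
  have hmem : ∀ s, 0 ≤ s → s ∈ Set.Ico (t (I s)) (t (I s + 1)) := fun s hs => by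
    refine ⟨?_, Nat.find_spec (hex s)⟩
    rcases Nat.eq_zero_or_pos (I s) with h | h
    · rw [h, ht0]; exact hs
    · have := Nat.find_min (hex s) (m := I s - 1) (Nat.sub_lt h one_pos)
      rw [show I s - 1 + 1 = I s by omega] at this
      exact not_lt.1 this
  -- the values at the switching instants, and the arcs between them
  let x : ℕ → E := fun k => Nat.rec z₀
    (fun k y => NormedSpace.exp ((t (k + 1) - t k) • A (σ (t k))) y) k
  let arc : ℕ → ℝ → E := fun k s => NormedSpace.exp ((s - t k) • A (σ (t k))) (x k)
  have harc0 : ∀ k, arc k (t k) = x k := fun k => by simp [arc]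
  have harc1 : ∀ k, arc k (t (k + 1)) = x (k + 1) := fun k => rfl
  have harcd : ∀ k s, HasDerivAt (arc k) (A (σ (t k)) (arc k s)) s := fun k s => by
    have h1 := (hasDerivAt_exp_smul_const' (A (σ (t k))) (s - t k)).scomp s
      ((hasDerivAt_id s).sub_const (t k))
    have h2 := h1.clm_apply (hasDerivAt_const s (x k))
    simpa using h2
  let z : ℝ → E := fun s => arc (I s) s
  have hz : ∀ k, ∀ s ∈ Set.Icc (t k) (t (k + 1)), z s = arc k s := fun k s hs => by
    rcases eq_or_lt_of_le hs.2 with h | h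
    · have h1 : I s = k + 1 := hI (k + 1) s ⟨h.ge, h ▸ hmono (Nat.lt_succ_self _)⟩
      have h2 : z s = arc (k + 1) s := by simp only [z, h1]
      rw [h2, h, harc0, harc1]
    · simp only [z, hI k s ⟨hs.1, h⟩]
  have hderiv : ∀ s, 0 ≤ s → HasDerivWithinAt z (A (σ s) (z s)) (Set.Ici s) s := fun s hs => by
    have hs' := hmem s hs
    rw [hconst _ s hs', hz _ s (Set.Ico_subset_Icc_self hs')]
    refine (harcd (I s) s).hasDerivWithinAt.congr_of_eventuallyEq ?_
      (hz _ s (Set.Ico_subset_Icc_self hs'))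
    filter_upwards [Ico_mem_nhdsGE hs'.2] with r hr
    exact hz _ r ⟨hs'.1.trans hr.1, hr.2.le⟩
  refine ⟨z, ?_, fun s hs => ?_, hderiv⟩
  · have : (0 : ℝ) ∈ Set.Icc (t 0) (t 1) := ⟨ht0.le, ht0 ▸ (hmono one_pos).le⟩
    rw [hz 0 0 this, ← ht0, harc0]
    rfl
  · rcases eq_or_lt_of_le (Set.mem_Ici.1 hs) with h0 | h0
    · rw [← h0]
      exact (hderiv 0 le_rfl).continuousWithinAt
    have hleft : ContinuousWithinAt z (Set.Iic s) s := by
      -- the arc that ends at or after `s` and starts before it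
      obtain ⟨k, hk1, hk2⟩ : ∃ k, t k < s ∧ s ≤ t (k + 1) := by
        have hs' := hmem s hs
        rcases eq_or_lt_of_le hs'.1 with h | h
        · have hpos : 0 < I s := by
            by_contra hcon
            rw [Nat.eq_zero_of_not_pos hcon, ht0] at h
            linarith
          refine ⟨I s - 1, ?_, ?_⟩
          · exact (hmono (Nat.sub_lt hpos one_pos)).trans_eq h
          · rw [show I s - 1 + 1 = I s by omega]; exact h.ge
        · exact ⟨_, h, hs'.2.le⟩
      refine (harcd k s).continuousAt.continuousWithinAt.congr_of_eventuallyEq ?_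
        (hz k s ⟨hk1.le, hk2⟩)
      filter_upwards [Ioc_mem_nhdsLE hk1] with r hr
      exact hz k r ⟨hr.1.le, hr.2.trans hk2⟩
    have := hleft.union (hderiv s hs).continuousWithinAt
    rw [Set.Iic_union_Ici] at this
    exact this.mono (Set.subset_univ _)

/-! ### The closed loop -/

lemma DecaysAt.comp {E ι κ : Type*} [NormedAddCommGroup E] [NormedSpace ℝ E] {f : ι → E → E}
    {a : ℝ} (h : DecaysAt f a) (r : κ → ι) : DecaysAt (fun k => f (r k)) a := by
  obtain ⟨P, hP, hd⟩ := h
  exact ⟨P, hP, fun k => hd (r k)⟩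

lemma isSolution_clm_comp {E ι : Type} [NormedAddCommGroup E] [NormedSpace ℝ E] [Fintype ι]
    {z z' : ℝ → E} (hc : ContinuousOn z (Set.Ici 0))
    (hd : ∀ t, 0 ≤ t → HasDerivWithinAt z (z' t) (Set.Ici t) t) (L : E →L[ℝ] (ι → ℝ)) :
    IsSolution (fun t => L (z t)) (fun t => L (z' t)) :=
  ⟨L.continuous.comp_continuousOn hc, fun t ht => L.hasFDerivAt.comp_hasDerivWithinAt t (hd t ht)⟩

namespace MultiAgentSystem

variable {N q m : ℕ} (M : MultiAgentSystem N q m)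

/-- The states `(x, ζ, ξ)` of follower `i`, of its state observer and of its internal model. -/
abbrev FollowerSpace (i : Fin N) : Type :=
  (Fin (M.n i) → ℝ) × (Fin (M.n i) → ℝ) × (Fin q × Fin M.pm → ℝ)

variable {M}

/-- The control `u` of follower `i` as a function of `(x, ζ, ξ)`. -/
noncomputable def controlMap (K : M.Gains) (i : Fin N) :
    M.FollowerSpace i →ₗ[ℝ] (Fin (M.p i) → ℝ) where
  toFun X := K.K1 i *ᵥ X.2.1 + K.K2 i *ᵥ X.2.2
  map_add' X Y := by simp only [Prod.fst_add, Prod.snd_add, mulVec_add]; abel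
  map_smul' c X := by simp [mulVec_smul]

/-- The output `y` of follower `i` as a function of `(x, ζ, ξ)`. -/
noncomputable def outputMap (K : M.Gains) (w : M.Uncertainty) (i : Fin N) :
    M.FollowerSpace i →ₗ[ℝ] (Fin q → ℝ) where
  toFun X := M.Cw w i *ᵥ X.1 + M.Dw w i *ᵥ controlMap K i X
  map_add' X Y := by simp only [Prod.fst_add, map_add, mulVec_add]; abel
  map_smul' c X := by simp [mulVec_smul]

/-- The closed-loop vector field of `(x, ζ, ξ)` for follower `i`, without the input `G₂ F η`. -/
noncomputable def followerField (K : M.Gains) (w : M.Uncertainty) (i : Fin N) :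
    M.FollowerSpace i →ₗ[ℝ] M.FollowerSpace i where
  toFun X := (M.Aw w i *ᵥ X.1 + M.Bw w i *ᵥ controlMap K i X,
    M.A i *ᵥ X.2.1 + M.B i *ᵥ controlMap K i X + K.K3 i *ᵥ
      (outputMap K w i X - M.C i *ᵥ X.2.1 - M.D i *ᵥ controlMap K i X),
    M.G1 *ᵥ X.2.2 + M.G2 *ᵥ outputMap K w i X)
  map_add' X Y := by
    simp only [Prod.fst_add, Prod.snd_add, map_add, mulVec_add, mulVec_sub, Prod.mk_add_mk,
      Prod.mk.injEq]
    exact ⟨by abel, by abel, by abel⟩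
  map_smul' c X := by simp [mulVec_smul, mulVec_sub, smul_add, smul_sub]

/-- The input `G₂ F η` to the internal model of follower `i`. -/
noncomputable def couplingMap (i : Fin N) : (Fin m → ℝ) →ₗ[ℝ] M.FollowerSpace i :=
  LinearMap.inr ℝ _ _ ∘ₗ LinearMap.inr ℝ _ _ ∘ₗ M.G2.mulVecLin ∘ₗ M.F.mulVecLin

lemma couplingMap_apply (i : Fin N) (η : Fin m → ℝ) :
    couplingMap (M := M) i η = (0, 0, M.G2 *ᵥ (M.F *ᵥ η)) := rfl

/-- In the coordinates `((x, ξ), x - ζ)` the nominal closed loop is a cascade of the estimation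
error and the state feedback of the augmented system. -/
lemma decaysAt_followerField_zero {K : M.Gains} {i : Fin N} {a b : ℝ}
    (hK : DecaysAt (fun (_ : Unit) x =>
      (M.augA i + M.augB i * fromCols (K.K1 i) (K.K2 i)) *ᵥ x) a)
    (hL : DecaysAt (fun (_ : Unit) x => (M.A i - K.K3 i * M.C i) *ᵥ x) a) (hab : b < a) :
    DecaysAt (fun _ : Unit => followerField K 0 i) b := by
  let g : (Fin (M.n i) → ℝ) →L[ℝ] (Fin (M.n i) ⊕ (Fin q × Fin M.pm) → ℝ) :=
    LinearMap.toContinuousLinearMap (-(M.augB i * K.K1 i).mulVecLin)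
  let T : M.FollowerSpace i →ₗ[ℝ]
      (Fin (M.n i) ⊕ (Fin q × Fin M.pm) → ℝ) × (Fin (M.n i) → ℝ) :=
    { toFun := fun X => (Sum.elim X.1 X.2.2, X.1 - X.2.1)
      map_add' := fun X Y => by
        refine Prod.ext ?_ ?_
        · ext k; cases k <;> simp
        · simp only [Prod.fst_add, Prod.snd_add]; abel
      map_smul' := fun c X => by
        refine Prod.ext ?_ ?_
        · ext k; cases k <;> simp
        · simp [smul_sub] }
  refine (hK.cascade hL g hab).of_injective (LinearMap.toContinuousLinearMap T) ?_ ?_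
  · intro X Y hXY
    have h1 : Sum.elim X.1 X.2.2 = Sum.elim Y.1 Y.2.2 := congrArg Prod.fst hXY
    have h2 : X.1 - X.2.1 = Y.1 - Y.2.1 := congrArg Prod.snd hXY
    have h3 : X.1 = Y.1 := funext fun k => congrFun h1 (Sum.inl k)
    have h4 : X.2.2 = Y.2.2 := funext fun k => congrFun h1 (Sum.inr k)
    rw [h3, sub_right_inj] at h2
    exact Prod.ext h3 (Prod.ext h2 h4)
  · rintro - ⟨x, ζ, ξ⟩
    have hA0 : M.Aw 0 i = M.A i := by ext; simp [Aw, toBlocks₁₁]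
    have hB0 : M.Bw 0 i = M.B i := by ext; simp [Bw, toBlocks₁₂]
    have hC0 : M.Cw 0 i = M.C i := by ext; simp [Cw, toBlocks₂₁]
    have hD0 : M.Dw 0 i = M.D i := by ext; simp [Dw, toBlocks₂₂]
    set u := K.K1 i *ᵥ ζ + K.K2 i *ᵥ ξ with hu
    have hy : outputMap K 0 i (x, ζ, ξ) = M.C i *ᵥ x + M.D i *ᵥ u := by
      rw [← hC0, ← hD0]; rfl
    have hf : followerField K 0 i (x, ζ, ξ) = (M.A i *ᵥ x + M.B i *ᵥ u,
        M.A i *ᵥ ζ + M.B i *ᵥ u + K.K3 i *ᵥ (M.C i *ᵥ x + M.D i *ᵥ u - M.C i *ᵥ ζ - M.D i *ᵥ u),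
        M.G1 *ᵥ ξ + M.G2 *ᵥ (M.C i *ᵥ x + M.D i *ᵥ u)) := by
      have e : followerField K 0 i (x, ζ, ξ) = (M.Aw 0 i *ᵥ x + M.Bw 0 i *ᵥ u,
          M.A i *ᵥ ζ + M.B i *ᵥ u
            + K.K3 i *ᵥ (outputMap K 0 i (x, ζ, ξ) - M.C i *ᵥ ζ - M.D i *ᵥ u),
          M.G1 *ᵥ ξ + M.G2 *ᵥ outputMap K 0 i (x, ζ, ξ)) := rfl
      rw [e, hA0, hB0, hy]
    rw [hf]
    refine Prod.ext ?_ ?_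
    · change Sum.elim (M.A i *ᵥ x + M.B i *ᵥ u) (M.G1 *ᵥ ξ + M.G2 *ᵥ (M.C i *ᵥ x + M.D i *ᵥ u))
        = (M.augA i + M.augB i * fromCols (K.K1 i) (K.K2 i)) *ᵥ Sum.elim x ξ
          + -((M.augB i * K.K1 i) *ᵥ (x - ζ))
      have h1 : (M.augB i * fromCols (K.K1 i) (K.K2 i)) *ᵥ Sum.elim x ξ
          = M.augB i *ᵥ (K.K1 i *ᵥ x + K.K2 i *ᵥ ξ) := by
        rw [← mulVec_mulVec, fromCols_mulVec_sumElim]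
      have h2 : M.augA i *ᵥ Sum.elim x ξ
          = Sum.elim (M.A i *ᵥ x) (M.G1 *ᵥ ξ + M.G2 *ᵥ (M.C i *ᵥ x)) := by
        rw [augA, fromBlocks_mulVec]
        simp [mulVec_mulVec, add_comm]
      have h3 : M.augB i *ᵥ u = Sum.elim (M.B i *ᵥ u) (M.G2 *ᵥ (M.D i *ᵥ u)) := by
        rw [augB, fromRows_mulVec, mulVec_mulVec]
      have h4 : K.K1 i *ᵥ x + K.K2 i *ᵥ ξ = u + K.K1 i *ᵥ (x - ζ) := by
        rw [hu, mulVec_sub]; abel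
      rw [add_mulVec, h1, h4, h2, mulVec_add (M.augB i) u, h3, ← mulVec_mulVec]
      ext k
      cases k <;> simp [mulVec_add, add_assoc]
    · change M.A i *ᵥ x + M.B i *ᵥ u - (M.A i *ᵥ ζ + M.B i *ᵥ u
          + K.K3 i *ᵥ (M.C i *ᵥ x + M.D i *ᵥ u - M.C i *ᵥ ζ - M.D i *ᵥ u))
        = (M.A i - K.K3 i * M.C i) *ᵥ (x - ζ)
      simp only [sub_mulVec, mulVec_sub, mulVec_add, ← mulVec_mulVec]
      abel

lemma continuous_followerField (K : M.Gains) (i : Fin N) :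
    Continuous fun p : M.Uncertainty × M.FollowerSpace i => followerField K p.1 i p.2 := by
  have hw : ∀ k l, Continuous fun p : M.Uncertainty × M.FollowerSpace i => p.1 i k l :=
    fun k l => by fun_prop
  have hA : Continuous fun p : M.Uncertainty × M.FollowerSpace i => M.Aw p.1 i :=
    continuous_const.add (continuous_matrix fun k l => hw _ _)
  have hB : Continuous fun p : M.Uncertainty × M.FollowerSpace i => M.Bw p.1 i :=
    continuous_const.add (continuous_matrix fun k l => hw _ _)
  have hC : Continuous fun p : M.Uncertainty × M.FollowerSpace i => M.Cw p.1 i :=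
    continuous_const.add (continuous_matrix fun k l => hw _ _)
  have hD : Continuous fun p : M.Uncertainty × M.FollowerSpace i => M.Dw p.1 i :=
    continuous_const.add (continuous_matrix fun k l => hw _ _)
  have hu : Continuous fun p : M.Uncertainty × M.FollowerSpace i => controlMap K i p.2 :=
    (LinearMap.continuous_of_finiteDimensional _).comp continuous_snd
  have hy : Continuous fun p : M.Uncertainty × M.FollowerSpace i => outputMap K p.1 i p.2 :=
    (hC.matrix_mulVec (by fun_prop)).add (hD.matrix_mulVec hu)
  have hx : Continuous fun p : M.Uncertainty × M.FollowerSpace i => p.2.1 := by fun_prop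
  have hζ : Continuous fun p : M.Uncertainty × M.FollowerSpace i => p.2.2.1 := by fun_prop
  have hξ : Continuous fun p : M.Uncertainty × M.FollowerSpace i => p.2.2.2 := by fun_prop
  have hc : ∀ {k l : Type} [Fintype l] (X : Matrix k l ℝ)
      {f : M.Uncertainty × M.FollowerSpace i → l → ℝ}, Continuous f →
      Continuous fun p => X *ᵥ f p := fun X _ hf => continuous_const.matrix_mulVec hf
  exact ((hA.matrix_mulVec hx).add (hB.matrix_mulVec hu)).prodMk
    ((((hc _ hζ).add (hc _ hu)).add (hc _ ((hy.sub (hc _ hζ)).sub (hc _ hu)))).prodMk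
      ((hc _ hξ).add (hc _ hy)))

/-- The regulator equations are solvable: there is a steady state `(x, ζ, ξ) = X v` on which the
output of follower `i` equals the output `-F v` of the leader. -/
lemma exists_steady_state {K : M.Gains} {w : M.Uncertainty} {i : Fin N} {a : ℝ}
    (h : DecaysAt (fun _ : Unit => followerField K w i) a)
    (ha : ∑ j, ∑ k, |M.S k j| < a) :
    ∃ X : (Fin m → ℝ) →ₗ[ℝ] M.FollowerSpace i,
      (∀ v, X (M.S *ᵥ v) = followerField K w i (X v) + couplingMap i v) ∧
      ∀ v, outputMap K w i (X v) + M.F *ᵥ v = 0 := by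
  obtain ⟨X, hX⟩ := h.exists_sylvester M.S ha (couplingMap i)
  refine ⟨X, hX, internalModel_input_eq_zero
    (X := LinearMap.snd ℝ _ _ ∘ₗ LinearMap.snd ℝ _ _ ∘ₗ X)
    (Y := outputMap K w i ∘ₗ X + M.F.mulVecLin) fun v => ?_⟩
  have h1 : (X (M.S *ᵥ v)).2.2
      = M.G1 *ᵥ (X v).2.2 + M.G2 *ᵥ outputMap K w i (X v) + M.G2 *ᵥ (M.F *ᵥ v) :=
    congrArg (fun Z => Z.2.2) (hX v)
  simp [h1, mulVec_add, add_assoc]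

/-- Every tracking error tends to zero: the deviation of the follower from its steady state is
driven only by the observer error of the leader, and both decay. -/
lemma IsTrajectory.tendsto_e {κ : ℕ} {G : Fin κ → CommGraph N} {K : M.Gains} {w : M.Uncertainty}
    {i : Fin N} {a : ℝ} (hf : DecaysAt (fun _ : Unit => followerField K w i) a)
    (hη : DecaysAt (fun k => M.observerError K.L0 (G k)) a)
    (ha : ∑ j, ∑ k, |M.S k j| < a) {σ : ℝ → Fin κ} {s : ℝ → M.State}
    (hs : M.IsTrajectory K w (fun t => G (σ t)) s) :
    Tendsto (fun t => (s t).e K w i) atTop (𝓝 0) := by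
  have ha0 : 0 < a := lt_of_le_of_lt
    (Finset.sum_nonneg fun j _ => Finset.sum_nonneg fun k _ => abs_nonneg _) ha
  obtain ⟨X, hX, hXe⟩ := exists_steady_state hf ha
  let g : (Fin N → Fin m → ℝ) →L[ℝ] M.FollowerSpace i :=
    LinearMap.toContinuousLinearMap (couplingMap i ∘ₗ LinearMap.proj i)
  let X' : (Fin m → ℝ) →L[ℝ] M.FollowerSpace i := LinearMap.toContinuousLinearMap X
  let Z : ℝ → M.FollowerSpace i := fun t => ((s t).x i, (s t).ζ i, (s t).ξ i)
  have hcasc := (hf.comp fun _ : Fin κ => ()).cascade hη g (half_lt_self ha0)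
  let z : ℝ → M.FollowerSpace i × (Fin N → Fin m → ℝ) :=
    fun t => (Z t - X' (s t).v, fun j => (s t).η j - (s t).v)
  suffices hlim : Tendsto z atTop (𝓝 0) by
    have h1 : Tendsto (fun t => outputMap K w i (Z t - X' (s t).v)) atTop (𝓝 0) := by
      have hc : Continuous (outputMap K w i) := LinearMap.continuous_of_finiteDimensional _
      exact (hc.tendsto' 0 0 (map_zero _)).comp hlim.fst_nhds
    refine h1.congr fun t => ?_
    have h2 : outputMap K w i (X' (s t).v) + M.F *ᵥ (s t).v = 0 := hXe _
    have h3 : (s t).e K w i = outputMap K w i (Z t) + M.F *ᵥ (s t).v := by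
      simp only [State.e, State.y0, sub_neg_eq_add]
      rfl
    rw [h3, map_sub, sub_eq_add_neg, ← eq_neg_of_add_eq_zero_right h2]
  refine hcasc.tendsto_zero (half_pos ha0) (σ := σ) ?_ ?_
  · exact (((hs.follower i).1.prodMk ((hs.stateObserver i).1.prodMk (hs.internalModel i).1)).sub
      (X'.continuous.comp_continuousOn hs.leader.1)).prodMk
      (continuousOn_pi.2 fun j => (hs.leaderObserver j).1.sub hs.leader.1)
  · intro t ht
    have hv := hs.leader.2 t ht
    have hZ := ((hs.follower i).2 t ht).prodMk
      (((hs.stateObserver i).2 t ht).prodMk ((hs.internalModel i).2 t ht))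
    have h1 := hZ.sub (X'.hasFDerivAt.comp_hasDerivWithinAt t hv)
    have h2 : HasDerivWithinAt (fun t => fun j => (s t).η j - (s t).v) _ (Set.Ici t) t :=
      hasDerivWithinAt_pi.2 fun j => ((hs.leaderObserver j).2 t ht).sub hv
    refine (h1.prodMk h2).congr_deriv (Prod.ext ?_ ?_)
    · have h3 : X' (M.S *ᵥ (s t).v) = followerField K w i (X (s t).v) + couplingMap i (s t).v :=
        hX _
      have h4 : g (fun j => (s t).η j - (s t).v)
          = couplingMap i ((s t).η i) - couplingMap i (s t).v :=
        map_sub (couplingMap i) _ _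
      have h5 : followerField K w i (Z t - X' (s t).v)
          = followerField K w i (Z t) - followerField K w i (X (s t).v) := map_sub _ _ _
      simp only [z, h3, h4, h5]
      have h6 : (M.Aw w i *ᵥ (s t).x i + M.Bw w i *ᵥ (s t).u K i,
          M.A i *ᵥ (s t).ζ i + M.B i *ᵥ (s t).u K i
            + K.K3 i *ᵥ ((s t).y K w i - M.C i *ᵥ (s t).ζ i - M.D i *ᵥ (s t).u K i),
          M.G1 *ᵥ (s t).ξ i + M.G2 *ᵥ ((s t).y K w i + M.F *ᵥ (s t).η i))
          = followerField K w i (Z t) + couplingMap i ((s t).η i) := by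
        rw [couplingMap_apply, mulVec_add, ← add_assoc]
        refine Prod.ext (add_zero _).symm (Prod.ext (add_zero _).symm rfl)
      rw [h6]
      abel
    · ext1 j
      have h7 : (s t).etaV (G (σ t)) j = ∑ l : Fin (N + 1), (G (σ t)).weight j.succ l •
          ((s t).η j - (s t).v - (Fin.cons 0 (fun j => (s t).η j - (s t).v) :
            Fin (N + 1) → Fin m → ℝ) l) := by
        refine Finset.sum_congr rfl fun l _ => ?_
        cases l using Fin.cases with
        | zero => simp
        | succ l => simp
      simp only [z, observerError, ← h7, mulVec_sub]
      abel

variable (M) in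
/-- The states `v`, `(x, ζ, ξ)` and `η` of the whole closed loop, as a vector space. -/
abbrev StateSpace : Type := (Fin m → ℝ) × (∀ i, M.FollowerSpace i) × (Fin N → Fin m → ℝ)

/-- The state of the closed loop with the given coordinates. -/
def StateSpace.toState (z : M.StateSpace) : M.State where
  v := z.1
  x i := (z.2.1 i).1
  ζ i := (z.2.1 i).2.1
  ξ i := (z.2.1 i).2.2
  η := z.2.2

/-- The estimate `ηᵢ` of the leader by follower `i`. -/
def leaderEstimate (i : Fin N) : M.StateSpace →ₗ[ℝ] (Fin m → ℝ) :=
  LinearMap.proj i ∘ₗ LinearMap.snd ℝ _ _ ∘ₗ LinearMap.snd ℝ _ _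

/-- The vector field of the closed loop under the communication graph `G`. -/
noncomputable def closedLoopField (K : M.Gains) (w : M.Uncertainty) (G : CommGraph N) :
    M.StateSpace →ₗ[ℝ] M.StateSpace :=
  (M.S.mulVecLin ∘ₗ LinearMap.fst ℝ _ _).prod <|
    (LinearMap.pi fun i => followerField K w i ∘ₗ LinearMap.proj i ∘ₗ LinearMap.fst ℝ _ _ ∘ₗ
      LinearMap.snd ℝ _ _ + couplingMap i ∘ₗ leaderEstimate i).prod <|
    LinearMap.pi fun i => M.S.mulVecLin ∘ₗ leaderEstimate i - K.L0.mulVecLin ∘ₗ M.F.mulVecLin ∘ₗ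
      ∑ j : Fin (N + 1), G.weight i.succ j • (leaderEstimate i
        - (Fin.cons (LinearMap.fst ℝ _ _) leaderEstimate :
          Fin (N + 1) → M.StateSpace →ₗ[ℝ] (Fin m → ℝ)) j)

lemma closedLoopField_snd_snd (K : M.Gains) (w : M.Uncertainty) (G : CommGraph N)
    (z : M.StateSpace) (i : Fin N) : (closedLoopField K w G z).2.2 i
      = M.S *ᵥ z.toState.η i - K.L0 *ᵥ (M.F *ᵥ z.toState.etaV G i) := by
  have h : z.toState.etaV G i = (∑ j : Fin (N + 1), G.weight i.succ j • (leaderEstimate i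
      - (Fin.cons (LinearMap.fst ℝ _ _) leaderEstimate :
        Fin (N + 1) → M.StateSpace →ₗ[ℝ] (Fin m → ℝ)) j) : M.StateSpace →ₗ[ℝ] (Fin m → ℝ)) z := by
    rw [LinearMap.sum_apply]
    refine Finset.sum_congr rfl fun j _ => ?_
    cases j using Fin.cases with
    | zero => rfl
    | succ j => rfl
  rw [h]
  rfl

lemma exists_isTrajectory {κ : ℕ} (G : Fin κ → CommGraph N) (K : M.Gains) (w : M.Uncertainty)
    {σ : ℝ → Fin κ} (hσ : IsSwitchingSignal σ) (s₀ : M.State) :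
    ∃ s : ℝ → M.State, s 0 = s₀ ∧ M.IsTrajectory K w (fun t => G (σ t)) s := by
  obtain ⟨z, hz0, hc, hd⟩ := exists_switched_solution hσ
    (fun k => LinearMap.toContinuousLinearMap (closedLoopField K w (G k)))
    ((s₀.v, fun i => (s₀.x i, s₀.ζ i, s₀.ξ i), s₀.η) : M.StateSpace)
  have hd' : ∀ t, 0 ≤ t →
      HasDerivWithinAt z (closedLoopField K w (G (σ t)) (z t)) (Set.Ici t) t := hd
  let prF : ∀ i, M.StateSpace →L[ℝ] M.FollowerSpace i := fun i =>
    (ContinuousLinearMap.proj i).comp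
      ((ContinuousLinearMap.fst ℝ _ _).comp (ContinuousLinearMap.snd ℝ _ _))
  let prη : Fin N → M.StateSpace →L[ℝ] (Fin m → ℝ) := fun i =>
    (ContinuousLinearMap.proj i).comp
      ((ContinuousLinearMap.snd ℝ _ _).comp (ContinuousLinearMap.snd ℝ _ _))
  have hF : ∀ t i, prF i (closedLoopField K w (G (σ t)) (z t))
      = followerField K w i (prF i (z t)) + (0, 0, M.G2 *ᵥ (M.F *ᵥ prη i (z t))) :=
    fun t i => rfl
  refine ⟨fun t => (z t).toState, ?_, ?_, fun i => ?_, fun i => ?_, fun i => ?_, fun i => ?_⟩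
  · simp only [hz0]; rfl
  · exact isSolution_clm_comp hc hd' (ContinuousLinearMap.fst ℝ _ _)
  · have := isSolution_clm_comp hc hd' ((ContinuousLinearMap.fst ℝ _ _).comp (prF i))
    simp only [ContinuousLinearMap.comp_apply, hF, map_add] at this
    simp only [ContinuousLinearMap.coe_fst', add_zero] at this
    exact this
  · have := isSolution_clm_comp hc hd' ((ContinuousLinearMap.fst ℝ _ _).comp
      ((ContinuousLinearMap.snd ℝ _ _).comp (prF i)))
    simp only [ContinuousLinearMap.comp_apply, hF, map_add] at this
    simp only [ContinuousLinearMap.coe_fst', ContinuousLinearMap.coe_snd', add_zero] at this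
    exact this
  · have := isSolution_clm_comp hc hd' ((ContinuousLinearMap.snd ℝ _ _).comp
      ((ContinuousLinearMap.snd ℝ _ _).comp (prF i)))
    simp only [mulVec_add, ← add_assoc]
    exact this
  · have := isSolution_clm_comp hc hd' (prη i)
    simp only [← closedLoopField_snd_snd K w]
    exact this

end MultiAgentSystem

end RobustConsensus

open RobustConsensus RobustConsensus.MultiAgentSystem Matrix Topology

theorem theorem2 {N q m κ : ℕ} (M : RobustConsensus.MultiAgentSystem N q m)
    (hctrl : ∀ i, RobustConsensus.IsControllable (M.A i) (M.B i))
    (hobs : ∀ i, RobustConsensus.IsObservable (M.C i) (M.A i))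
    (hleader : RobustConsensus.IsObservable M.F M.S)
    (G : Fin κ → RobustConsensus.CommGraph N)
    (hgraph : ∀ k, (G k).IsConnected)
    (htrans : M.TransmissionZeroCondition) :
    ∃ K : M.Gains, M.SolvesRobustConsensusTracking G K := by
  -- The steady state exists once the perturbed loop decays faster than `r`; one unit of rate is
  -- lost to the cascade and one to the perturbation.
  set r : ℝ := ∑ j, ∑ k, |M.S k j|
  obtain ⟨L₀, hL₀⟩ := exists_decaysAt_observerError (M := M) hgraph hleader (r + 1)
  choose K hK using fun i => exists_decaysAt_add_mul (M.augA i) (M.augB i)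
    (augmented_controllable htrans (hctrl i)) (r + 3)
  choose L hL using fun i => exists_decaysAt_sub_mul (M.A i) (M.C i)
    (fun x hx => (hobs i).eq_zero x hx) (r + 3)
  let gains : M.Gains := ⟨fun i => (K i).toCols₁, fun i => (K i).toCols₂, L, L₀⟩
  have hnom : ∀ i, DecaysAt (fun _ : Unit => followerField gains 0 i) (r + 2) := fun i =>
    decaysAt_followerField_zero (a := r + 3)
      (by simpa only [gains, fromCols_toCols] using hK i) (hL i) (by linarith)
  have hev : ∀ᶠ w in 𝓝 (0 : M.Uncertainty), ∀ i,
      DecaysAt (fun _ : Unit => followerField gains w i) (r + 1) :=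
    Filter.eventually_all.2 fun i => (hnom i).eventually
      (f := fun w => followerField gains w i) (continuous_followerField gains i)
      (fun w c x => map_smul _ c x) (by linarith)
  obtain ⟨W, hW, hWo, h0⟩ := eventually_nhds_iff.1 hev
  exact ⟨gains, W, hWo, h0, fun w hw σ hσ s₀ => ⟨exists_isTrajectory G gains w hσ s₀,
    fun s _ hs i => hs.tendsto_e (hW w hw i) hL₀ (by linarith)⟩⟩
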